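/- **Setting.** Targets $i=1,\dots,M$ at $x_i\in[0,L]$ and agents $k=1,\dots,N$ with sensing ranges $r_k>0$; horizon $T>0$; rates $0<A_i<B_i$. Agent $k$ starts at some point of $[0,L]$ and moves at unit speed to the switching points $\theta_{k1},\theta_{k2},\dots,\theta_{k\Gamma_k}\in[0,L]$ in this order; at some of them (those with a dwell time) it rests for the time $w_{kl}\ge 0$, at the others it goes on at once, and it stays at the last one. Let $s_k(t)$ be its position and $u_k(t)\in\{-1,0,1\}$ its (right-continuous) control, $\dot s_k=u_k$. Put $p_{ik}(s)=\max\{0,1-|x_i-s|/r_k\}$ and $P_i(t)=1-\prod_{k}(1-p_{ik}(s_k(t)))$. The uncertainty $R_i\ge 0$ of target $i$ is the continuous solution on $[0,T]$, with given $R_i(0)\ge 0$, of $\dot R_i=0$ if $R_i=0$ and $A_i\le B_iP_i$, and $\dot R_i=A_i-B_iP_i$ otherwise. The cost is $J(\theta,w)=\frac1T\int_0^T\sum_iR_i(t)\,dt$, and $\nabla_j$ is the vector of partial derivatives with respect to the switching points $\theta_{jl}$ and dwell times $w_{jl}$ of agent $j$. Let $\mathcal T_j(t)=\{i:|x_i-s_j(t)|\le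 r_j\}$ and $\mathcal N_{ij}(t)=\{k\ne j:|x_i-s_k(t)|\le r_k\}$. The events are: $\rho_i^0$, $\rho_i^+$ ($R_i$ hits, leaves $0$); $\pi_{ik}^0$, $\pi_{ik}^+$ ($p_{ik}(s_k(t))$ hits, leaves $0$); $\Delta_{ik}^{+}$, $\Delta_{ik}^-$ (an agent joins, leaves $\mathcal N_{ik}$); $\nu_k^{(a,b)}$ ($u_k$ switches from $a$ to $b\neq a$). Let $\mathcal E^A_k$ consist of the events $\nu_k^{(a,b)}$, and $\mathcal E^T_i$ of the events $\rho_i^0,\rho_i^+$ and $\pi_{ik}^0,\pi_{ik}^+,\Delta_{ik}^{+},\Delta_{ik}^-$ for all $k$. Put $\mathcal E_k(t)=\mathcal E_k^A\cup\bigcup_{i\in\mathcal T_k(t)}\mathcal E_i^T$ and $I_j(t)=\mathcal E_j(t)\cup\bigcup_{i\in\mathcal T_j(t),\,k\in\mathcal N_{ij}(t)}\mathcal E_k(t)$. Agent $j$ knows $N,M,L,T$, all $x_i,A_i,B_i,r_k$, and its own starting point, switching points and dwell times. Its *observation* consists of (i) all events that occur at a time $t\in(0,T)$ and belong to $I_j(t)\cup\{\rho_i^0:i\notin\mathcal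 T_j(t)\}$, with their times; (ii) at time $0$ and at the times $t$ of occurrence of events of $I_j(t)$, and at no other times, the values $R_i(t)$, $s_k(t)$, $u_k(t)$ for $i\in\mathcal T_j(t)$ and $k\in\mathcal N_{ij}(t)$. **Lemma 2.** The event set $I_j(t)\cup\{\rho_i^0:i\notin\mathcal T_j(t)\}$ is sufficient to evaluate the IPA gradient $\nabla_jJ(\theta,w)$: for every agent $j$ there is a function $\Phi$ of the starting point and parameters of agent $j$ and of its observation, not depending on the other agents' starting points and parameters or on the $R_i(0)$ in any other way, with the following property. Let $c$ be any one of the parameters $\theta_{jl}$, $w_{jl}$ of agent $j$ (with $w_{jl}>0$ in the second case), and suppose that the IPA state derivatives with respect to $c$ exist, that is, that for every $i$ and almost every $t\in[0,T]$ the partial derivative $\partial R_i(t)/\partial c$ exists. Then these derivatives are integrable in $t$, $\partial J/\partial c$ exists, and $$\frac{\partial J}{\partial c}(\theta,w)=\frac1T\sum_{i=1}^M\int_0^T\frac{\partial R_i(t)}{\partial c}\,dt=\Phi_c\big(\text{plan of agent }j,\ \text{observation of agent }j\big).$$ -/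

import Mathlib

open Set Filter Topology MeasureTheory

noncomputable section

namespace PersistentMonitoring

/-! The data known to everybody: mission space, horizon, sensing ranges, targets and their rates. -/

/-- `N` agents and `M` targets on the mission space `[0, L]`, with time horizon `[0, T]`. -/
structure World (N M : ℕ) where
  L : ℝ
  T : ℝ
  /-- sensing ranges of the agents -/
  r : Fin N → ℝ
  /-- locations of the targets -/
  x : Fin M → ℝ
  /-- growth rates of the target uncertainties -/
  A : Fin M → ℝ
  /-- depletion rates of the target uncertainties -/
  B : Fin M → ℝ
  T_pos : 0 < T
  r_pos : ∀ k, 0 < r k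
  x_mem : ∀ i, x i ∈ Icc 0 L
  A_pos : ∀ i, 0 < A i
  A_lt_B : ∀ i, A i < B i

/-! Parametrized agent trajectories. -/

/-- An agent starts at `start`, moves at unit speed to the switching points
`point 0`, …, `point (n - 1)` in this order, and rests at `point l` for the time `dwell l` if
`l ∈ stops` (for `l ∉ stops` it goes on at once, and no dwell time is involved). Having reached the
last switching point, it stays there. The values `point l`, `dwell l` with `l ≥ n` and the values
`dwell l` with `l ∉ stops` play no role. -/
structure Plan where
  start : ℝ
  n : ℕ
  point : ℕ → ℝ
  stops : Finset ℕ
  dwell : ℕ → ℝ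

/-- Names of the scalar parameters of an agent: its switching points and its dwell times. -/
inductive Param where
  | point (l : ℕ) : Param
  | dwell (l : ℕ) : Param

namespace Plan

/-- The parameters that a plan really has. -/
def params (p : Plan) : Set Param :=
  {c | match c with
    | .point l => l < p.n
    | .dwell l => l < p.n ∧ l ∈ p.stops}

/-- The value of a parameter. -/
def value (p : Plan) : Param → ℝ
  | .point l => p.point l
  | .dwell l => p.dwell l

/-- The plan in which the parameter `c` has been given the value `v`. -/
def withValue (p : Plan) (c : Param) (v : ℝ) : Plan :=
  match c with
  | .point l => { p with point := Function.update p.point l v }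
  | .dwell l => { p with dwell := Function.update p.dwell l v }

/-- The starting point, followed by the switching points. -/
def waypoint (p : Plan) : ℕ → ℝ
  | 0 => p.start
  | l + 1 => p.point l

/-- The time at which the agent leaves `waypoint l` for `waypoint (l + 1)`. -/
def departure (p : Plan) : ℕ → ℝ
  | 0 => 0
  | l + 1 => departure p l + |p.waypoint (l + 1) - p.waypoint l| +
      (if l ∈ p.stops then p.dwell l else 0)

/-- The time at which the agent reaches `waypoint (l + 1)`, coming from `waypoint l`. -/
def arrival (p : Plan) (l : ℕ) : ℝ :=
  p.departure l + |p.waypoint (l + 1) - p.waypoint l|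

open Classical in
/-- The control `u(t)`, with values `-1`, `0`, `1` when the dwell times are nonnegative. -/
def control (p : Plan) (t : ℝ) : ℝ :=
  ∑ l ∈ Finset.range p.n,
    if p.departure l ≤ t ∧ t < p.arrival l then
      (SignType.sign (p.waypoint (l + 1) - p.waypoint l) : ℝ) else 0

/-- The position `s(t)`, that is, the solution of `s' = u` from the starting point. -/
def position (p : Plan) (t : ℝ) : ℝ :=
  p.start + ∫ τ in (0 : ℝ)..t, p.control τ

end Plan

/-- The plans of all agents, with the initial uncertainties of all targets. -/
structure Scenario (N M : ℕ) where
  plan : Fin N → Plan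
  R₀ : Fin M → ℝ

variable {N M : ℕ}

namespace Scenario

/-- All agents stay in the mission space, dwell times and initial uncertainties are nonnegative. -/
structure Feasible (W : World N M) (S : Scenario N M) : Prop where
  start_mem : ∀ k, (S.plan k).start ∈ Icc 0 W.L
  point_mem : ∀ k, ∀ l < (S.plan k).n, (S.plan k).point l ∈ Icc 0 W.L
  dwell_nonneg : ∀ k, ∀ l < (S.plan k).n, l ∈ (S.plan k).stops → 0 ≤ (S.plan k).dwell l
  R₀_nonneg : ∀ i, 0 ≤ S.R₀ i

/-- The scenario in which agent `j` follows the plan `p` instead. -/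
def withPlan (S : Scenario N M) (j : Fin N) (p : Plan) : Scenario N M :=
  { S with plan := Function.update S.plan j p }

/-- The position `s_k(t)` of agent `k`. -/
def pos (S : Scenario N M) (k : Fin N) (t : ℝ) : ℝ := (S.plan k).position t

/-- The control `u_k(t)` of agent `k`. -/
def ctrl (S : Scenario N M) (k : Fin N) (t : ℝ) : ℝ := (S.plan k).control t

end Scenario

/-! Sensing and target dynamics. -/

/-- The probability `p_ik(s)` that agent `k`, at position `s`, detects an event at target `i`. -/
def detect (W : World N M) (i : Fin M) (k : Fin N) (s : ℝ) : ℝ :=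
  max 0 (1 - |W.x i - s| / W.r k)

/-- The joint detection probability `P_i(s(t))`. -/
def jointDetect (W : World N M) (S : Scenario N M) (i : Fin M) (t : ℝ) : ℝ :=
  1 - ∏ k, (1 - detect W i k (S.pos k t))

open Classical in
/-- The right-hand side of the dynamics of the uncertainty of target `i`, at the value `ϱ`. -/
def rate (W : World N M) (S : Scenario N M) (i : Fin M) (t ϱ : ℝ) : ℝ :=
  if ϱ = 0 ∧ W.A i ≤ W.B i * jointDetect W S i t then 0
  else W.A i - W.B i * jointDetect W S i t

/-- `R i t` is the uncertainty of target `i` at time `t` in the scenario `S`: the nonnegative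
continuous solution on `[0, T]` of `R_i' = rate` (a right derivative at every time, since the
right-hand side jumps when `R_i` reaches zero) with the prescribed initial value. -/
structure IsUncertainty (W : World N M) (S : Scenario N M) (R : Fin M → ℝ → ℝ) : Prop where
  init : ∀ i, R i 0 = S.R₀ i
  nonneg : ∀ i, ∀ t ∈ Icc 0 W.T, 0 ≤ R i t
  cont : ∀ i, ContinuousOn (R i) (Icc 0 W.T)
  dynamics : ∀ i, ∀ t ∈ Ico 0 W.T,
    HasDerivWithinAt (R i) (rate W S i t (R i t)) (Ici t) t

/-- The cost `J`: the time average of the total uncertainty. -/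
def cost (W : World N M) (R : Fin M → ℝ → ℝ) : ℝ :=
  (1 / W.T) * ∫ t in (0 : ℝ)..W.T, ∑ i, R i t

/-! Neighborhoods. -/

/-- `T_j(t)`: the targets within the sensing range of agent `j`. -/
def targetNbhd (W : World N M) (S : Scenario N M) (j : Fin N) (t : ℝ) : Set (Fin M) :=
  {i | |W.x i - S.pos j t| ≤ W.r j}

/-- `B_i(t)`: the agents that have target `i` within their sensing range. -/
def agentNbhd (W : World N M) (S : Scenario N M) (i : Fin M) (t : ℝ) : Set (Fin N) :=
  {k | |S.pos k t - W.x i| ≤ W.r k}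

/-- `N_ij(t)`: the collaborators of agent `j` in sensing target `i`. -/
def collaborators (W : World N M) (S : Scenario N M) (i : Fin M) (j : Fin N) (t : ℝ) :
    Set (Fin N) :=
  agentNbhd W S i t \ {j}

/-! Events. -/

/-- The events of the hybrid system. -/
inductive Event (N M : ℕ) where
  /-- `R_i` hits 0 -/
  | rhoZero (i : Fin M) : Event N M
  /-- `R_i` leaves 0 -/
  | rhoPlus (i : Fin M) : Event N M
  /-- `p_ij(s_j)` hits 0 -/
  | piZero (i : Fin M) (j : Fin N) : Event N M
  /-- `p_ij(s_j)` leaves 0 -/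
  | piPlus (i : Fin M) (j : Fin N) : Event N M
  /-- `u_j` switches from `a` to `b` -/
  | nu (j : Fin N) (a b : SignType) : Event N M
  /-- an agent joins `N_ij` -/
  | deltaPlus (i : Fin M) (j : Fin N) : Event N M
  /-- an agent leaves `N_ij` -/
  | deltaMinus (i : Fin M) (j : Fin N) : Event N M

/-- `f` is positive just before `τ` and zero at `τ`. -/
def HitsZero (f : ℝ → ℝ) (τ : ℝ) : Prop :=
  f τ = 0 ∧ ∀ᶠ t in 𝓝[<] τ, 0 < f t

/-- `f` is zero at `τ` and positive just after `τ`. -/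
def LeavesZero (f : ℝ → ℝ) (τ : ℝ) : Prop :=
  f τ = 0 ∧ ∀ᶠ t in 𝓝[>] τ, 0 < f t

/-- The event happens at time `τ`. -/
def Occurs (W : World N M) (S : Scenario N M) (R : Fin M → ℝ → ℝ) (τ : ℝ) :
    Event N M → Prop
  | .rhoZero i => HitsZero (R i) τ
  | .rhoPlus i => LeavesZero (R i) τ
  | .piZero i j => HitsZero (fun t => detect W i j (S.pos j t)) τ
  | .piPlus i j => LeavesZero (fun t => detect W i j (S.pos j t)) τ
  | .nu j a b => a ≠ b ∧ (∀ᶠ t in 𝓝[<] τ, S.ctrl j t = (a : ℝ)) ∧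
      ∀ᶠ t in 𝓝[>] τ, S.ctrl j t = (b : ℝ)
  | .deltaPlus i j => ∃ k, (∀ᶠ t in 𝓝[<] τ, k ∉ collaborators W S i j t) ∧
      ∀ᶠ t in 𝓝[>] τ, k ∈ collaborators W S i j t
  | .deltaMinus i j => ∃ k, (∀ᶠ t in 𝓝[<] τ, k ∈ collaborators W S i j t) ∧
      ∀ᶠ t in 𝓝[>] τ, k ∉ collaborators W S i j t

/-- The control switches of agent `j`. -/
def agentEvents (j : Fin N) : Set (Event N M) :=
  {e | ∃ a b, e = .nu j a b}

/-- The events related to target `i`, for all agents. -/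
def targetEvents (i : Fin M) : Set (Event N M) :=
  {e | e = .rhoZero i ∨ e = .rhoPlus i ∨
    ∃ k, e = .piZero i k ∨ e = .piPlus i k ∨ e = .deltaPlus i k ∨ e = .deltaMinus i k}

/-- The local event set of agent `j` at time `t`. -/
def localEvents (W : World N M) (S : Scenario N M) (j : Fin N) (t : ℝ) : Set (Event N M) :=
  agentEvents j ∪ ⋃ i ∈ targetNbhd W S j t, targetEvents i

/-- The local information set `I_j(t)`: the local events of agent `j` and of its collaborators on
the targets within its range. -/
def localInfo (W : World N M) (S : Scenario N M) (j : Fin N) (t : ℝ) : Set (Event N M) :=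
  localEvents W S j t ∪
    ⋃ i ∈ targetNbhd W S j t, ⋃ k ∈ collaborators W S i j t, localEvents W S k t

/-- The uncertainty depletion events of the targets out of the range of agent `j` at time `t`. -/
def remoteDepletions (W : World N M) (S : Scenario N M) (j : Fin N) (t : ℝ) :
    Set (Event N M) :=
  {e | ∃ i, i ∉ targetNbhd W S j t ∧ e = .rhoZero i}

/-! What agent `j` gets to know. -/

/-- A state value that an agent reads off: the uncertainty of a target, or the position or the
control of an agent. -/
inductive Reading (N M : ℕ) where
  | uncertainty (i : Fin M) (v : ℝ) : Reading N M
  | position (k : Fin N) (v : ℝ) : Reading N M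
  | control (k : Fin N) (v : ℝ) : Reading N M

/-- The readings available to agent `j` at time `t`: the uncertainties of the targets within its
range, and the positions and controls of the other agents sensing one of these targets. -/
def localReadings (W : World N M) (S : Scenario N M) (R : Fin M → ℝ → ℝ) (j : Fin N) (t : ℝ) :
    Set (Reading N M) :=
  {x | ∃ i ∈ targetNbhd W S j t, x = .uncertainty i (R i t) ∨
    ∃ k ∈ collaborators W S i j t, x = .position k (S.pos k t) ∨ x = .control k (S.ctrl k t)}

/-- A list of events with their times, and of local readings with their times. -/
structure Observation (N M : ℕ) where
  events : Set (ℝ × Event N M)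
  readings : Set (ℝ × Reading N M)

/-- What agent `j` learns over the horizon: the events in the event set
`I_j(t) ∪ {ρ_i^0 : i ∉ T_j(t)}`, with the times of their occurrence, and the local readings at
time `0` and at the times of events in `I_j(t)` (at no other time). -/
def observe (W : World N M) (S : Scenario N M) (R : Fin M → ℝ → ℝ) (j : Fin N) :
    Observation N M where
  events := {x | x.1 ∈ Ioo 0 W.T ∧ Occurs W S R x.1 x.2 ∧
    x.2 ∈ localInfo W S j x.1 ∪ remoteDepletions W S j x.1}
  readings := {x | (x.1 = 0 ∨ x.1 ∈ Ioo 0 W.T ∧ ∃ e ∈ localInfo W S j x.1, Occurs W S R x.1 e) ∧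
    x.2 ∈ localReadings W S R j x.1}

end PersistentMonitoring

end

open PersistentMonitoring

noncomputable section

namespace PersistentMonitoring

variable {N M : ℕ}

/-! It suffices to show that what agent `j` does not see is irrelevant to its gradient: if two
admissible scenarios share the plan and the observation of `j`, then ∂R_i(t)/∂c is the same in both
for almost every t (`Indistinguishable.deriv_uncertainty_eq`). Φ may then pick any scenario that
fits the data. Integrability and differentiation under the integral follow from a Lipschitz bound on
R_i in c that is uniform in time (`hasDerivAt_cost`).

Fix t and let a be the last zero of R_i up to t, or 0 if there is none. At time a the actual R_i is
minimal among its values for all choices of the parameter, and R_i always grows at least at the rate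
A_i - B_i P_i, with equality while it is positive. Together with the assumed differentiability this
forces ∂R_i(t)/∂c to be the derivative of ∫_a^t (A_i - B_i P_i) with a held fixed
(`hasDerivAt_integral_drift`); this is the reset of the IPA derivative at a depletion, obtained
without differentiating event times. In this integral c enters only through p_ij(s_j), multiplied by
the weight Q(s) for s > a, where Q is the product of the 1 - p_ik over k ≠ j. Times at which i is
out of range of j do not count, since there p_ij vanishes for nearby parameters too
(`hasDerivAt_integral_detect_mul`).

So the weights must agree at almost all times in range. While j and k share a target, each entry,
joining or control switch triggers a reading, and motion is uniform in between; by induction along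
time s_k is known, hence Q, and then R_i as well (`agent_eq`, `missByOthers_eq`, `uncertainty_eq`).
The last zeros may differ, say a < a'. If i were in range just after some s in (a, a'], the two
uncertainties would agree at s and be positive, so the second would hit zero in (s, a']. Depletions
are observed even out of range, so the first would vanish after its last zero, a contradiction
(`not_inRange_of_depleted`). -/

/-! ### Trajectories and their Lipschitz dependence on the parameters -/

/-- The signed distance covered in the time `max y 0` on a leg with displacement `d`. -/
def legProgress (y d : ℝ) : ℝ := max (-max y 0) (min (max y 0) d)

/-- With y⁺ = max y 0, `legProgress y d` is d clamped to [-y⁺, y⁺], which covers both directions of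
travel. Clamping is Lipschitz in the value and in the endpoints, so positions are Lipschitz in the
parameters although controls jump. -/
theorem abs_legProgress_sub_le (y d y' d' : ℝ) :
    |legProgress y d - legProgress y' d'| ≤ |y - y'| + |d - d'| := by
  have h0 : |max y 0 - max y' 0| ≤ |y - y'| := by
    simpa using abs_max_sub_max_le_max y 0 y' 0
  have h1 := abs_min_sub_min_le_max (max y 0) d (max y' 0) d'
  have h2 := abs_max_sub_max_le_max (-max y 0) (min (max y 0) d) (-max y' 0) (min (max y' 0) d')
  have h3 : |-max y 0 - -max y' 0| = |max y 0 - max y' 0| := by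
    rw [← abs_neg]; congr 1; ring
  rw [h3] at h2
  refine h2.trans (max_le ?_ (h1.trans (max_le ?_ ?_)))
  all_goals linarith [abs_nonneg (y - y'), abs_nonneg (d - d')]

theorem continuous_legProgress (d : ℝ) : Continuous fun y => legProgress y d := by
  unfold legProgress; fun_prop

open Classical in
theorem hasDerivWithinAt_legProgress (a d x : ℝ) :
    HasDerivWithinAt (fun t => legProgress (t - a) d)
      (if a ≤ x ∧ x < a + |d| then (SignType.sign d : ℝ) else 0) (Ioi x) x := by
  rcases lt_or_ge x a with hx | hx
  · rw [if_neg (by intro h; linarith [h.1])]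
    refine (hasDerivWithinAt_const x (Ioi x) (max 0 (min 0 d))).congr_of_eventuallyEq ?_ ?_
    · filter_upwards [Ioo_mem_nhdsGT hx] with t ht
      simp [legProgress, max_eq_right (show t - a ≤ 0 by linarith [ht.2])]
    · simp [legProgress, max_eq_right (show x - a ≤ 0 by linarith)]
  rcases lt_or_ge x (a + |d|) with hx' | hx'
  · rw [if_pos ⟨hx, hx'⟩]
    have key : ∀ t, x ≤ t → t < a + |d| →
        legProgress (t - a) d = (SignType.sign d : ℝ) * (t - a) := by
      intro t h1 h2
      rw [legProgress, max_eq_left (show 0 ≤ t - a by linarith)]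
      rcases lt_trichotomy d 0 with h | h | h
      · rw [abs_of_neg h] at h2
        rw [min_eq_right (by linarith), max_eq_left (by linarith)]
        simp [h]
      · subst h
        simp at h2 hx'
        linarith
      · rw [abs_of_pos h] at h2
        rw [min_eq_left (by linarith), max_eq_right (by linarith)]
        simp [h]
    have hd : HasDerivWithinAt (fun t => (SignType.sign d : ℝ) * (t - a)) (SignType.sign d : ℝ)
        (Ioi x) x := by
      simpa using (((hasDerivAt_id x).sub_const a).const_mul (SignType.sign d : ℝ)).hasDerivWithinAt
    refine hd.congr_of_eventuallyEq ?_ (key x le_rfl hx')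
    filter_upwards [Ioo_mem_nhdsGT hx'] with t ht using key t ht.1.le ht.2
  · rw [if_neg (by intro h; linarith [h.2])]
    have key : ∀ t, x ≤ t → legProgress (t - a) d = d := by
      intro t h1
      rw [legProgress, max_eq_left (show 0 ≤ t - a by linarith)]
      rw [min_eq_right (by linarith [le_abs_self d]), max_eq_right (by linarith [neg_abs_le d])]
    refine (hasDerivWithinAt_const x (Ioi x) d).congr_of_eventuallyEq ?_ (key x le_rfl)
    filter_upwards [self_mem_nhdsWithin] with t ht using key t (le_of_lt ht)

namespace Plan

variable (p : Plan)

open Classical in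
theorem intervalIntegrable_leg (p : Plan) (l : ℕ) (a b : ℝ) :
    IntervalIntegrable (fun t => if p.departure l ≤ t ∧ t < p.arrival l then
      (SignType.sign (p.waypoint (l + 1) - p.waypoint l) : ℝ) else 0) volume a b := by
  have : (fun t => if p.departure l ≤ t ∧ t < p.arrival l then
      (SignType.sign (p.waypoint (l + 1) - p.waypoint l) : ℝ) else 0) =
      (Ico (p.departure l) (p.arrival l)).indicator
        (fun _ => (SignType.sign (p.waypoint (l + 1) - p.waypoint l) : ℝ)) := by
    ext t; simp [indicator, mem_Ico]
  rw [this]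
  refine ⟨?_, ?_⟩ <;>
  · refine IntegrableOn.indicator ?_ measurableSet_Ico
    exact (integrableOn_const (by simp))

theorem intervalIntegrable_control (p : Plan) (a b : ℝ) :
    IntervalIntegrable p.control volume a b := by
  classical
  have := IntervalIntegrable.sum (μ := volume) (a := a) (b := b) (Finset.range p.n)
    (fun l _ => p.intervalIntegrable_leg l a b)
  have h : p.control = ∑ l ∈ Finset.range p.n, fun t =>
      if p.departure l ≤ t ∧ t < p.arrival l then
        (SignType.sign (p.waypoint (l + 1) - p.waypoint l) : ℝ) else 0 := by
    ext t
    rw [Finset.sum_apply]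
    rfl
  rw [h]
  exact this

theorem continuous_position (p : Plan) : Continuous p.position :=
  continuous_const.add (intervalIntegral.continuous_primitive p.intervalIntegrable_control 0)

theorem position_sub (p : Plan) (s t : ℝ) :
    p.position t - p.position s = ∫ τ in s..t, p.control τ := by
  unfold position
  rw [add_sub_add_left_eq_sub,
    intervalIntegral.integral_interval_sub_left (p.intervalIntegrable_control _ _)
      (p.intervalIntegrable_control _ _)]

theorem position_eq_of_control_eq (p : Plan) {s t a : ℝ} (hst : s ≤ t)
    (h : ∀ τ ∈ Ioo s t, p.control τ = a) : p.position t = p.position s + a * (t - s) := by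
  have h1 := p.position_sub s t
  rw [intervalIntegral.integral_of_le hst, integral_Ioc_eq_integral_Ioo,
    setIntegral_congr_fun measurableSet_Ioo h, ← integral_Ioc_eq_integral_Ioo,
    ← intervalIntegral.integral_of_le hst, intervalIntegral.integral_const, smul_eq_mul] at h1
  linarith

theorem eventually_control_right (p : Plan) (τ : ℝ) :
    ∀ᶠ t in 𝓝[>] τ, p.control t = p.control τ := by
  classical
  have : ∀ l ∈ Finset.range p.n, ∀ᶠ t in 𝓝[>] τ,
      ((p.departure l ≤ t ∧ t < p.arrival l) ↔ (p.departure l ≤ τ ∧ τ < p.arrival l)) := by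
    intro l _
    have h1 : ∀ᶠ t in 𝓝[>] τ, (p.departure l ≤ t ↔ p.departure l ≤ τ) := by
      rcases le_or_gt (p.departure l) τ with h | h
      · filter_upwards [self_mem_nhdsWithin] with t ht
        simp only [h, iff_true]; exact h.trans (le_of_lt ht)
      · filter_upwards [Ioo_mem_nhdsGT h] with t ht
        simp [not_le.2 h, not_le.2 ht.2]
    have h2 : ∀ᶠ t in 𝓝[>] τ, (t < p.arrival l ↔ τ < p.arrival l) := by
      rcases le_or_gt (p.arrival l) τ with h | h
      · filter_upwards [self_mem_nhdsWithin] with t ht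
        simp only [not_lt.2 h, not_lt.2 (h.trans (le_of_lt ht))]
      · filter_upwards [Ioo_mem_nhdsGT h] with t ht
        simp [h, ht.2]
    filter_upwards [h1, h2] with t h1 h2
    rw [h1, h2]
  filter_upwards [(Finset.eventually_all _).2 this] with t ht
  refine Finset.sum_congr rfl fun l hl => ?_
  simp only [ht l hl]

/-- The left limit need not be the value at τ. Expressing it as the control at a sample time keeps
it among the values covered by `exists_control_eq`. -/
theorem exists_eventually_control_left (p : Plan) (τ : ℝ) :
    ∃ s, ∀ᶠ t in 𝓝[<] τ, p.control t = p.control s := by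
  classical
  have : ∀ l ∈ Finset.range p.n, ∀ᶠ t in 𝓝[<] τ,
      ((p.departure l ≤ t ∧ t < p.arrival l) ↔ (p.departure l < τ ∧ τ ≤ p.arrival l)) := by
    intro l _
    have h1 : ∀ᶠ t in 𝓝[<] τ, (p.departure l ≤ t ↔ p.departure l < τ) := by
      rcases lt_or_ge (p.departure l) τ with h | h
      · filter_upwards [Ioo_mem_nhdsLT h] with t ht
        simp [h, ht.1.le]
      · filter_upwards [self_mem_nhdsWithin] with t ht
        simp only [not_lt.2 h, not_le.2 (lt_of_lt_of_le ht h)]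
    have h2 : ∀ᶠ t in 𝓝[<] τ, (t < p.arrival l ↔ τ ≤ p.arrival l) := by
      rcases lt_or_ge (p.arrival l) τ with h | h
      · filter_upwards [Ioo_mem_nhdsLT h] with t ht
        simp [not_le.2 h, ht.1.le]
      · filter_upwards [self_mem_nhdsWithin] with t ht
        simp only [h, iff_true]; exact lt_of_lt_of_le ht h
    filter_upwards [h1, h2] with t h1 h2
    rw [h1, h2]
  have h := (Finset.eventually_all _).2 this
  obtain ⟨s, hs⟩ := h.exists
  refine ⟨s, ?_⟩
  filter_upwards [h] with t ht
  refine Finset.sum_congr rfl fun l hl => ?_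
  simp only [ht l hl, hs l hl]

/-- Along a plan with nonnegative dwell times, the legs follow one another. -/
theorem arrival_le_departure (p : Plan) (h : ∀ l < p.n, l ∈ p.stops → 0 ≤ p.dwell l) {l m : ℕ}
    (hlm : l < m) (hm : m < p.n) : p.arrival l ≤ p.departure m := by
  have h0 : ∀ l, l < p.n → p.arrival l ≤ p.departure (l + 1) := by
    intro l hl
    rw [arrival, departure]
    split_ifs with hs
    · linarith [h l hl hs]
    · linarith
  induction m with
  | zero => omega
  | succ m ih =>
    rcases Nat.lt_succ_iff_lt_or_eq.1 hlm with h1 | h1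
    · have h2 := ih h1 (by omega)
      have h3 := h0 m (by omega)
      have : p.departure m ≤ p.arrival m := by
        rw [arrival]; linarith [abs_nonneg (p.waypoint (m + 1) - p.waypoint m)]
      linarith
    · subst h1; exact h0 _ (by omega)

/-- The legs do not overlap, so at most one summand of the control is nonzero. -/
theorem exists_control_eq (p : Plan) (h : ∀ l < p.n, l ∈ p.stops → 0 ≤ p.dwell l) (t : ℝ) :
    ∃ a : SignType, p.control t = (a : ℝ) := by
  classical
  by_cases hl : ∃ l ∈ Finset.range p.n, p.departure l ≤ t ∧ t < p.arrival l
  · obtain ⟨l, hl, ht⟩ := hl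
    refine ⟨SignType.sign (p.waypoint (l + 1) - p.waypoint l), ?_⟩
    rw [control, Finset.sum_eq_single_of_mem l hl, if_pos ht]
    intro m hm hml
    rw [if_neg]
    rintro ⟨h1, h2⟩
    rw [Finset.mem_range] at hl hm
    rcases lt_or_gt_of_ne hml with h3 | h3
    · linarith [p.arrival_le_departure h h3 hl, ht.1]
    · linarith [p.arrival_le_departure h h3 hm, ht.2]
  · push Not at hl
    refine ⟨0, ?_⟩
    rw [control, Finset.sum_eq_zero]
    · simp
    · intro l h1
      rw [if_neg]
      rintro ⟨h2, h3⟩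
      linarith [hl l h1 h2]

/-- The fundamental theorem of calculus, leg by leg. No sign condition on the dwell times is needed,
so perturbed plans are covered; departures may then be negative, whence the subtracted values at
time 0. -/
theorem position_eq_sum (p : Plan) (t : ℝ) :
    p.position t = p.start + ∑ l ∈ Finset.range p.n,
      (legProgress (t - p.departure l) (p.waypoint (l + 1) - p.waypoint l) -
        legProgress (0 - p.departure l) (p.waypoint (l + 1) - p.waypoint l)) := by
  classical
  unfold position control
  rw [intervalIntegral.integral_finsetSum fun l _ => p.intervalIntegrable_leg l 0 t]
  congr 1
  refine Finset.sum_congr rfl fun l _ => ?_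
  refine intervalIntegral.integral_eq_sub_of_hasDeriv_right
    (f := fun t => legProgress (t - p.departure l) (p.waypoint (l + 1) - p.waypoint l)) ?_ ?_
    (p.intervalIntegrable_leg l 0 t)
  · exact ((continuous_legProgress _).comp (continuous_id.sub continuous_const)).continuousOn
  · intro x _
    exact hasDerivWithinAt_legProgress _ _ x

theorem abs_waypoint_withValue_sub_le (p : Plan) (c : Param) (v w : ℝ) (l : ℕ) :
    |(p.withValue c v).waypoint l - (p.withValue c w).waypoint l| ≤ |v - w| := by
  cases l with
  | zero => cases c <;> simp [withValue, waypoint]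
  | succ l =>
    cases c with
    | point m =>
      by_cases h : l = m
      · subst h; simp [withValue, waypoint]
      · simp [withValue, waypoint, Function.update_of_ne h]
    | dwell m => simp [withValue, waypoint]

theorem abs_dwell_withValue_sub_le (p : Plan) (c : Param) (v w : ℝ) (l : ℕ) :
    |(p.withValue c v).dwell l - (p.withValue c w).dwell l| ≤ |v - w| := by
  cases c with
  | point m => simp [withValue]
  | dwell m =>
    by_cases h : l = m
    · subst h; simp [withValue]
    · simp [withValue, Function.update_of_ne h]

@[simp] theorem withValue_n (p : Plan) (c : Param) (v : ℝ) : (p.withValue c v).n = p.n := by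
  cases c <;> rfl

@[simp] theorem withValue_stops (p : Plan) (c : Param) (v : ℝ) :
    (p.withValue c v).stops = p.stops := by
  cases c <;> rfl

@[simp] theorem withValue_start (p : Plan) (c : Param) (v : ℝ) :
    (p.withValue c v).start = p.start := by
  cases c <;> rfl

@[simp] theorem withValue_value (p : Plan) (c : Param) : p.withValue c (p.value c) = p := by
  cases c <;> simp [withValue, value]

theorem abs_displacement_withValue_sub_le (p : Plan) (c : Param) (v w : ℝ) (l : ℕ) :
    |((p.withValue c v).waypoint (l + 1) - (p.withValue c v).waypoint l) -
      ((p.withValue c w).waypoint (l + 1) - (p.withValue c w).waypoint l)| ≤ 2 * |v - w| := by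
  have h1 := p.abs_waypoint_withValue_sub_le c v w (l + 1)
  have h2 := p.abs_waypoint_withValue_sub_le c v w l
  rw [abs_le] at *
  constructor <;> linarith [h1.1, h1.2, h2.1, h2.2]

/-- Each leg adds at most 2|v - w| through its length and |v - w| through its dwell time. -/
theorem abs_departure_withValue_sub_le (p : Plan) (c : Param) (v w : ℝ) (l : ℕ) :
    |(p.withValue c v).departure l - (p.withValue c w).departure l| ≤ 3 * l * |v - w| := by
  induction l with
  | zero => simp [departure]
  | succ l ih =>
    have h1 := (abs_abs_sub_abs_le_abs_sub _ _).trans (p.abs_displacement_withValue_sub_le c v w l)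
    have h2 := p.abs_dwell_withValue_sub_le c v w l
    simp only [departure, withValue_stops]
    push_cast
    have h3 := abs_nonneg (v - w)
    split_ifs
    all_goals
      rw [abs_le] at *
      constructor <;> linarith [h1.1, h1.2, h2.1, h2.2, ih.1, ih.2]

/-- The position depends on each parameter in a Lipschitz way, uniformly in time. -/
theorem exists_abs_position_withValue_sub_le (p : Plan) (c : Param) :
    ∃ C : ℝ, 0 ≤ C ∧ ∀ v w t,
      |(p.withValue c v).position t - (p.withValue c w).position t| ≤ C * |v - w| := by
  -- Departure (3l) and displacement (2) contribute at both times `t` and `0`: 2(3l + 2) = 6l + 4.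
  refine ⟨∑ l ∈ Finset.range p.n, (6 * l + 4 : ℝ), Finset.sum_nonneg fun l _ => by positivity, ?_⟩
  intro v w t
  rw [position_eq_sum, position_eq_sum]
  simp only [withValue_n, withValue_start]
  rw [add_sub_add_left_eq_sub, ← Finset.sum_sub_distrib, Finset.sum_mul]
  refine (Finset.abs_sum_le_sum_abs _ _).trans (Finset.sum_le_sum fun l _ => ?_)
  have key : ∀ t : ℝ, |legProgress (t - (p.withValue c v).departure l)
        ((p.withValue c v).waypoint (l + 1) - (p.withValue c v).waypoint l) -
      legProgress (t - (p.withValue c w).departure l)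
        ((p.withValue c w).waypoint (l + 1) - (p.withValue c w).waypoint l)| ≤
      (3 * l + 2) * |v - w| := by
    intro t
    refine (abs_legProgress_sub_le _ _ _ _).trans ?_
    have h1 := p.abs_displacement_withValue_sub_le c v w l
    have h2 := p.abs_departure_withValue_sub_le c v w l
    rw [← abs_neg] at h2
    rw [show t - (p.withValue c v).departure l - (t - (p.withValue c w).departure l) =
      -((p.withValue c v).departure l - (p.withValue c w).departure l) by ring]
    linarith
  have h1 := key t
  have h2 := key 0
  rw [abs_le] at *
  constructor <;> linarith [h1.1, h1.2, h2.1, h2.2]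

end Plan

/-! Comparison of uncertainties. -/

/-- A continuous function that has nonpositive right derivatives where it is positive remains
nonpositive. -/
theorem nonpos_of_right_deriv_nonpos {d d' : ℝ → ℝ} {a b : ℝ} (hd : ContinuousOn d (Icc a b))
    (hd' : ∀ t ∈ Ico a b, HasDerivWithinAt d (d' t) (Ici t) t) (ha : d a ≤ 0)
    (h : ∀ t ∈ Ico a b, 0 < d t → d' t ≤ 0) : ∀ t ∈ Icc a b, d t ≤ 0 := by
  intro t ht
  have key : ∀ ε > 0, d t ≤ ε * (1 + (t - a)) := by
    intro ε hε
    -- The barrier has positive height and slope ε: at a contact `d` is positive, so its right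
    -- derivative is at most 0 < ε and it cannot cross.
    refine image_le_of_deriv_right_lt_deriv_boundary' (f := d) (f' := d')
      (B := fun s => ε * (1 + (s - a))) (B' := fun _ => ε) hd hd' ?_ (by fun_prop) ?_ ?_ ht
    · simp; linarith
    · intro x _
      simpa using ((((hasDerivAt_id x).sub_const a).const_add 1).const_mul ε).hasDerivWithinAt
    · intro x hx hx'
      have : 0 < d x := by
        rw [hx']
        have := hx.1
        have : 0 < 1 + (x - a) := by linarith
        positivity
      linarith [h x hx this]
  have h1 : 0 < 1 + (t - a) := by linarith [ht.1]
  refine le_of_forall_pos_le_add fun ε hε => ?_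
  have := key (ε / (1 + (t - a))) (by positivity)
  rw [div_mul_cancel₀ _ h1.ne'] at this
  linarith

/-- The rate at which the uncertainty of target `i` changes while it is positive. -/
def drift (W : World N M) (S : Scenario N M) (i : Fin M) (t : ℝ) : ℝ :=
  W.A i - W.B i * jointDetect W S i t

theorem World.B_pos (W : World N M) (i : Fin M) : 0 < W.B i := (W.A_pos i).trans (W.A_lt_B i)

theorem detect_nonneg (W : World N M) (i : Fin M) (k : Fin N) (s : ℝ) : 0 ≤ detect W i k s :=
  le_max_left _ _

theorem detect_le_one (W : World N M) (i : Fin M) (k : Fin N) (s : ℝ) : detect W i k s ≤ 1 :=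
  max_le zero_le_one (by
    have := div_nonneg (abs_nonneg (W.x i - s)) (W.r_pos k).le
    linarith)

theorem detect_eq_zero (W : World N M) {i : Fin M} {k : Fin N} {s : ℝ} (h : W.r k ≤ |W.x i - s|) :
    detect W i k s = 0 := by
  refine max_eq_left ?_
  have := (one_le_div (W.r_pos k)).2 h
  linarith

theorem detect_pos (W : World N M) {i : Fin M} {k : Fin N} {s : ℝ} (h : |W.x i - s| < W.r k) :
    0 < detect W i k s := by
  refine lt_max_of_lt_right ?_
  have := (div_lt_one (W.r_pos k)).2 h
  linarith

theorem abs_detect_sub_le (W : World N M) (i : Fin M) (k : Fin N) (s s' : ℝ) :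
    |detect W i k s - detect W i k s'| ≤ |s - s'| / W.r k := by
  have h1 : |detect W i k s - detect W i k s'| ≤
      |(1 - |W.x i - s| / W.r k) - (1 - |W.x i - s'| / W.r k)| := by
    have := abs_max_sub_max_le_max 0 (1 - |W.x i - s| / W.r k) 0 (1 - |W.x i - s'| / W.r k)
    simpa [detect] using this
  refine h1.trans ?_
  rw [show (1 - |W.x i - s| / W.r k) - (1 - |W.x i - s'| / W.r k) =
    (|W.x i - s'| - |W.x i - s|) / W.r k by ring, abs_div, abs_of_pos (W.r_pos k)]
  refine div_le_div_of_nonneg_right ?_ (W.r_pos k).le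
  have := abs_abs_sub_abs_le_abs_sub (W.x i - s') (W.x i - s)
  rwa [show W.x i - s' - (W.x i - s) = s - s' by ring] at this

theorem continuous_detect (W : World N M) (i : Fin M) (k : Fin N) : Continuous (detect W i k) := by
  unfold detect; fun_prop

theorem Scenario.continuous_pos (S : Scenario N M) (k : Fin N) : Continuous (S.pos k) :=
  (S.plan k).continuous_position

theorem continuous_jointDetect (W : World N M) (S : Scenario N M) (i : Fin M) :
    Continuous (jointDetect W S i) := by
  unfold jointDetect
  exact continuous_const.sub (continuous_finsetProd _ fun k _ =>
    continuous_const.sub ((continuous_detect W i k).comp (S.continuous_pos k)))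

theorem continuous_drift (W : World N M) (S : Scenario N M) (i : Fin M) :
    Continuous (drift W S i) :=
  continuous_const.sub (continuous_const.mul (continuous_jointDetect W S i))

/-- Where the dynamics hold the uncertainty at zero, the drift is nonpositive. This one-sided bound,
valid across all depletion phases, is what makes estimates possible without tracking events. -/
theorem drift_le_rate (W : World N M) (S : Scenario N M) (i : Fin M) (t ϱ : ℝ) :
    drift W S i t ≤ rate W S i t ϱ := by
  unfold rate drift
  split_ifs with h
  · linarith [h.2]
  · exact le_rfl

theorem rate_of_pos (W : World N M) (S : Scenario N M) (i : Fin M) (t : ℝ) {ϱ : ℝ} (h : 0 < ϱ) :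
    rate W S i t ϱ = drift W S i t :=
  if_neg fun h' => h.ne' h'.1

section

variable {W : World N M} {S S' : Scenario N M} {R R' : Fin M → ℝ → ℝ} {i : Fin M} {a b K : ℝ}

theorem IsUncertainty.continuousOn_Icc (hR : IsUncertainty W S R) (ha : 0 ≤ a) (hb : b ≤ W.T) :
    ContinuousOn (R i) (Icc a b) :=
  (hR.cont i).mono (Icc_subset_Icc ha hb)

theorem IsUncertainty.integral_drift_le (hR : IsUncertainty W S R) (ha : 0 ≤ a) (hab : a ≤ b)
    (hb : b ≤ W.T) : ∫ t in a..b, drift W S i t ≤ R i b - R i a := by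
  refine intervalIntegral.integral_le_sub_of_hasDeriv_right_of_le hab
    (hR.continuousOn_Icc ha hb) (g' := fun t => rate W S i t (R i t)) ?_ ?_ ?_
  · intro x hx
    exact (hR.dynamics i x ⟨ha.trans hx.1.le, hx.2.trans_le hb⟩).mono Ioi_subset_Ici_self
  · exact (continuous_drift W S i).continuousOn.integrableOn_compact isCompact_Icc
  · intro x _
    exact drift_le_rate W S i x _

theorem IsUncertainty.integral_drift_eq (hR : IsUncertainty W S R) (ha : 0 ≤ a) (hab : a ≤ b)
    (hb : b ≤ W.T) (hpos : ∀ t ∈ Ioo a b, 0 < R i t) :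
    ∫ t in a..b, drift W S i t = R i b - R i a := by
  refine intervalIntegral.integral_eq_sub_of_hasDeriv_right_of_le hab
    (hR.continuousOn_Icc ha hb) ?_ ((continuous_drift W S i).intervalIntegrable _ _)
  intro x hx
  have := (hR.dynamics i x ⟨ha.trans hx.1.le, hx.2.trans_le hb⟩).mono Ioi_subset_Ici_self
  rwa [rate_of_pos W S i x (hpos x hx)] at this

/-- Where R - R' exceeds K(t - a), R is positive and grows exactly at its drift, while R' grows at
least at its own; so the excess cannot increase. -/
theorem IsUncertainty.sub_le (hR : IsUncertainty W S R) (hR' : IsUncertainty W S' R')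
    (ha : 0 ≤ a) (hb : b ≤ W.T) (h0 : R i a ≤ R' i a)
    (hK : ∀ t ∈ Ico a b, |drift W S i t - drift W S' i t| ≤ K) :
    ∀ t ∈ Icc a b, R i t - R' i t ≤ K * (t - a) := by
  intro t ht
  have := nonpos_of_right_deriv_nonpos (d := fun t => R i t - R' i t - K * (t - a))
    (d' := fun t => rate W S i t (R i t) - rate W S' i t (R' i t) - K) (a := a) (b := b)
    (((hR.continuousOn_Icc ha hb).sub (hR'.continuousOn_Icc ha hb)).sub (by fun_prop)) ?_ ?_ ?_ t ht
  · simpa using this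
  · intro s hs
    have hs' : s ∈ Ico 0 W.T := ⟨ha.trans hs.1, hs.2.trans_le hb⟩
    have h1 : HasDerivWithinAt (fun t => K * (t - a)) K (Ici s) s := by
      simpa using (((hasDerivAt_id s).sub_const a).const_mul K).hasDerivWithinAt
    exact ((hR.dynamics i s hs').sub (hR'.dynamics i s hs')).sub h1
  · simpa using h0
  · intro s hs hpos
    have hK0 : 0 ≤ K := (abs_nonneg _).trans (hK s hs)
    have h1 : 0 ≤ R' i s := hR'.nonneg i s ⟨ha.trans hs.1, hs.2.le.trans hb⟩
    have h2 : 0 ≤ K * (s - a) := mul_nonneg hK0 (by linarith [hs.1])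
    rw [rate_of_pos W S i s (by linarith)]
    have h3 := drift_le_rate W S' i s (R' i s)
    have h4 := (abs_le.1 (hK s hs)).2
    linarith

theorem IsUncertainty.abs_sub_le (hR : IsUncertainty W S R) (hR' : IsUncertainty W S' R')
    (ha : 0 ≤ a) (hb : b ≤ W.T) (h0 : R i a = R' i a)
    (hK : ∀ t ∈ Ico a b, |drift W S i t - drift W S' i t| ≤ K) :
    ∀ t ∈ Icc a b, |R i t - R' i t| ≤ K * (t - a) := by
  intro t ht
  have h1 := hR.sub_le hR' ha hb h0.le hK t ht
  have h2 := hR'.sub_le hR ha hb h0.ge (fun s hs => by rw [abs_sub_comm]; exact hK s hs) t ht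
  exact abs_le.2 ⟨by linarith, h1⟩

theorem IsUncertainty.eq_of_drift_eq (hR : IsUncertainty W S R) (hR' : IsUncertainty W S' R')
    (ha : 0 ≤ a) (hb : b ≤ W.T) (h0 : R i a = R' i a)
    (h : ∀ t ∈ Ico a b, drift W S i t = drift W S' i t) : ∀ t ∈ Icc a b, R i t = R' i t := by
  intro t ht
  have := hR.abs_sub_le hR' ha hb h0 (K := 0) (fun s hs => by simp [h s hs]) t ht
  rw [zero_mul] at this
  exact sub_eq_zero.1 (abs_nonpos_iff.1 this)

end

/-! Dependence on the plan of agent `j`. -/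

/-- The probability that no agent other than `j` detects an event at target `i`. -/
def missByOthers (W : World N M) (S : Scenario N M) (j : Fin N) (i : Fin M) (t : ℝ) : ℝ :=
  ∏ k ∈ Finset.univ.erase j, (1 - detect W i k (S.pos k t))

theorem jointDetect_eq (W : World N M) (S : Scenario N M) (j : Fin N) (i : Fin M) (t : ℝ) :
    jointDetect W S i t = 1 - (1 - detect W i j (S.pos j t)) * missByOthers W S j i t := by
  rw [jointDetect, missByOthers, Finset.mul_prod_erase _
    (fun k => 1 - detect W i k (S.pos k t)) (Finset.mem_univ j)]

theorem continuous_missByOthers (W : World N M) (S : Scenario N M) (j : Fin N) (i : Fin M) :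
    Continuous (missByOthers W S j i) :=
  continuous_finsetProd _ fun k _ =>
    continuous_const.sub ((continuous_detect W i k).comp (S.continuous_pos k))

theorem missByOthers_nonneg (W : World N M) (S : Scenario N M) (j : Fin N) (i : Fin M) (t : ℝ) :
    0 ≤ missByOthers W S j i t :=
  Finset.prod_nonneg fun k _ => by linarith [detect_le_one W i k (S.pos k t)]

theorem missByOthers_le_one (W : World N M) (S : Scenario N M) (j : Fin N) (i : Fin M) (t : ℝ) :
    missByOthers W S j i t ≤ 1 :=
  Finset.prod_le_one (fun k _ => by linarith [detect_le_one W i k (S.pos k t)])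
    fun k _ => by linarith [detect_nonneg W i k (S.pos k t)]

@[simp] theorem Scenario.withPlan_self (S : Scenario N M) (j : Fin N) :
    S.withPlan j (S.plan j) = S := by
  simp [Scenario.withPlan]

@[simp] theorem Scenario.pos_withPlan_self (S : Scenario N M) (j : Fin N) (p : Plan) (t : ℝ) :
    (S.withPlan j p).pos j t = p.position t := by
  simp [Scenario.withPlan, Scenario.pos]

@[simp] theorem missByOthers_withPlan (W : World N M) (S : Scenario N M) (j : Fin N) (p : Plan)
    (i : Fin M) (t : ℝ) : missByOthers W (S.withPlan j p) j i t = missByOthers W S j i t := by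
  refine Finset.prod_congr rfl fun k hk => ?_
  simp [Scenario.withPlan, Scenario.pos, Function.update_of_ne (Finset.ne_of_mem_erase hk)]

theorem drift_withPlan (W : World N M) (S : Scenario N M) (j : Fin N) (p : Plan) (i : Fin M)
    (t : ℝ) : drift W (S.withPlan j p) i t =
      W.A i - W.B i + W.B i * ((1 - detect W i j (p.position t)) * missByOthers W S j i t) := by
  rw [drift, jointDetect_eq W _ j, Scenario.pos_withPlan_self, missByOthers_withPlan]
  ring

theorem exists_abs_drift_withValue_sub_le (W : World N M) (S : Scenario N M) (j : Fin N) (p : Plan)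
    (c : Param) (i : Fin M) : ∃ C : ℝ, 0 ≤ C ∧ ∀ v w t,
      |drift W (S.withPlan j (p.withValue c v)) i t -
        drift W (S.withPlan j (p.withValue c w)) i t| ≤ C * |v - w| := by
  obtain ⟨C, hC, h⟩ := p.exists_abs_position_withValue_sub_le c
  have hr := W.r_pos j
  have hB := W.B_pos i
  refine ⟨W.B i * (C / W.r j), by positivity, fun v w t => ?_⟩
  rw [drift_withPlan, drift_withPlan]
  rw [show ∀ a b p q m : ℝ, a + b * ((1 - p) * m) - (a + b * ((1 - q) * m)) =
    b * (-(p - q) * m) by intros; ring, abs_mul, abs_mul, abs_neg, abs_of_pos hB, mul_assoc]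
  refine mul_le_mul_of_nonneg_left ?_ hB.le
  have h1 := (abs_detect_sub_le W i j ((p.withValue c v).position t)
    ((p.withValue c w).position t)).trans (div_le_div_of_nonneg_right (h v w t) hr.le)
  rw [show C / W.r j * |v - w| = C * |v - w| / W.r j by ring]
  have h2 : |missByOthers W S j i t| ≤ 1 := by
    rw [abs_of_nonneg (missByOthers_nonneg W S j i t)]
    exact missByOthers_le_one W S j i t
  calc _ ≤ (C * |v - w| / W.r j) * 1 := mul_le_mul h1 h2 (abs_nonneg _) (by positivity)
    _ = _ := mul_one _

/-- The uncertainties depend on each parameter in a Lipschitz way, uniformly in time. -/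
theorem exists_abs_uncertainty_withValue_sub_le {W : World N M} {S : Scenario N M} {j : Fin N}
    {R : Plan → Fin M → ℝ → ℝ} (hR : ∀ p, IsUncertainty W (S.withPlan j p) (R p)) (p : Plan)
    (c : Param) (i : Fin M) : ∃ C : ℝ, 0 ≤ C ∧ ∀ v w, ∀ t ∈ Icc 0 W.T,
      |R (p.withValue c v) i t - R (p.withValue c w) i t| ≤ C * |v - w| := by
  obtain ⟨C, hC, h⟩ := exists_abs_drift_withValue_sub_le W S j p c i
  have hT := W.T_pos
  refine ⟨C * W.T, by positivity, fun v w t ht => ?_⟩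
  have := (hR (p.withValue c v)).abs_sub_le (hR (p.withValue c w)) (i := i) le_rfl le_rfl
    (by rw [(hR _).init, (hR _).init]; rfl) (fun t _ => h v w t) t ht
  refine this.trans ?_
  rw [sub_zero, mul_right_comm]
  exact mul_le_mul_of_nonneg_right (mul_le_mul_of_nonneg_left ht.2 hC) (abs_nonneg _)

/-! Sensitivity of the uncertainties to a parameter. -/

/-- A lower bound alone suffices: divided by v - x, it bounds the derivative from below for v > x
and from above for v < x. -/
theorem abs_deriv_le_of_lower_bound {g : ℝ → ℝ} {D K x : ℝ} (hg : HasDerivAt g D x)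
    (h : ∀ v, -(K * |v - x|) ≤ g v - g x) : |D| ≤ K := by
  refine le_of_forall_pos_le_add fun ε hε => ?_
  have h1 := (hasDerivAt_iff_isLittleO.1 hg).def hε
  obtain ⟨δ, hδ, hball⟩ := Metric.eventually_nhds_iff.1 h1
  have hd : 0 < δ / 2 := by positivity
  have ha := hball (y := x + δ / 2) (by simp [abs_of_pos hδ]; linarith)
  have hb := hball (y := x - δ / 2) (by simp [abs_of_pos hδ]; linarith)
  have ha' := h (x + δ / 2)
  have hb' := h (x - δ / 2)
  simp only [Real.norm_eq_abs, smul_eq_mul] at ha hb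
  rw [show x + δ / 2 - x = δ / 2 by ring, abs_of_pos hd] at ha ha'
  rw [show x - δ / 2 - x = -(δ / 2) by ring, abs_neg, abs_of_pos hd] at hb hb'
  have ha2 := (abs_le.1 ha).2
  have hb2 := (abs_le.1 hb).2
  rw [abs_le]
  constructor <;> nlinarith

section

variable {W : World N M} {S : Scenario N M} {j : Fin N} {R : Plan → Fin M → ℝ → ℝ}

/-- If the uncertainty of target `i` at time `a`, as a function of the parameter, is minimal at the
actual value, and if the target is uncertain on the way from `a` to `t`, then the sensitivity of the
uncertainty at time `t` stems from the detection probabilities between `a` and `t`. -/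
theorem hasDerivAt_integral_drift (hR : ∀ p, IsUncertainty W (S.withPlan j p) (R p)) (p : Plan)
    (c : Param) (i : Fin M)
    (hdiff : ∀ᵐ t ∂(volume.restrict (Icc 0 W.T)),
      DifferentiableAt ℝ (fun v => R (p.withValue c v) i t) (p.value c))
    {a t : ℝ} (ha : 0 ≤ a) (hat : a ≤ t) (ht : t ≤ W.T)
    (hmin : ∀ v, R p i a ≤ R (p.withValue c v) i a) (hpos : ∀ s ∈ Ioc a t, 0 < R p i s)
    (hdt : DifferentiableAt ℝ (fun v => R (p.withValue c v) i t) (p.value c)) :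
    HasDerivAt (fun v => ∫ s in a..t, drift W (S.withPlan j (p.withValue c v)) i s)
      (deriv (fun v => R (p.withValue c v) i t) (p.value c)) (p.value c) := by
  rcases hat.eq_or_lt with rfl | hat
  · have h0 : deriv (fun v => R (p.withValue c v) i a) (p.value c) = 0 := by
      refine IsLocalMin.deriv_eq_zero (Filter.Eventually.of_forall fun v => ?_)
      simpa using hmin v
    rw [h0]
    simpa using hasDerivAt_const (p.value c) (0 : ℝ)
  set x := p.value c with hx
  have hpx : p.withValue c x = p := p.withValue_value c
  obtain ⟨C, hC, hdrift⟩ := exists_abs_drift_withValue_sub_le W S j p c i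
  obtain ⟨C', hC', hunc⟩ := exists_abs_uncertainty_withValue_sub_le hR p c i
  set f : ℝ → ℝ → ℝ := fun v => drift W (S.withPlan j (p.withValue c v)) i with hf
  set Y : ℝ → ℝ → ℝ := fun v => R (p.withValue c v) i with hY
  have hYx : Y x = R p i := by simp only [hY, hpx]
  have hfi : ∀ v b b', IntervalIntegrable (f v) volume b b' := fun v b b' =>
    (continuous_drift W _ i).intervalIntegrable _ _
  have hbound : ∀ v b, a ≤ b → |(∫ s in a..b, f v s) - ∫ s in a..b, f x s| ≤
      C * |v - x| * (b - a) := by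
    intro v b hab
    rw [← intervalIntegral.integral_sub (hfi _ _ _) (hfi _ _ _)]
    have := intervalIntegral.norm_integral_le_of_norm_le_const (a := a) (b := b)
      (f := fun s => f v s - f x s) (C := C * |v - x|) (fun s _ => hdrift v x s)
    rwa [abs_of_nonneg (by linarith : 0 ≤ b - a)] at this
  have heq : ∀ b ∈ Ioc a t, ∫ s in a..b, f x s = Y x b - Y x a := by
    intro b hb
    refine (hR _).integral_drift_eq ha hb.1.le (hb.2.trans ht) fun s hs => ?_
    rw [hpx]
    exact hpos s ⟨hs.1, hs.2.le.trans hb.2⟩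
  have hlow : ∀ v, ∀ b ∈ Ioc a t,
      (∫ s in a..b, f v s) - ∫ s in a..b, f x s ≤ Y v b - Y x b := by
    intro v b hb
    have h1 : ∫ s in a..b, f v s ≤ Y v b - Y v a :=
      (hR _).integral_drift_le ha hb.1.le (hb.2.trans ht)
    have h2 : Y x a ≤ Y v a := by rw [hYx]; exact hmin v
    rw [heq b hb]
    linarith
  rw [hasDerivAt_iff_isLittleO]
  rw [Asymptotics.isLittleO_iff]
  intro ε hε
  -- Positivity may fail at `a`, so the argument restarts at a nearby `b` where the derivative
  -- exists. The `C + 1` guards against `C = 0`.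
  obtain ⟨b, hb, hbC, hbd⟩ : ∃ b ∈ Ioo a t, C * (b - a) ≤ ε / 4 ∧
      DifferentiableAt ℝ (fun v => Y v b) x := by
    set b₁ := min t (a + ε / (4 * (C + 1))) with hb₁
    have hab₁ : a < b₁ := lt_min hat (by have : 0 < ε / (4 * (C + 1)) := by positivity
                                         linarith)
    have hsub : Ioo a b₁ ⊆ Icc 0 W.T := fun s hs =>
      ⟨ha.trans hs.1.le, hs.2.le.trans ((min_le_left _ _).trans ht)⟩
    have h1 := ae_restrict_of_ae_restrict_of_subset hsub hdiff
    have h2 := ae_restrict_mem (μ := volume) (measurableSet_Ioo (a := a) (b := b₁))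
    have : NeBot (ae (volume.restrict (Ioo a b₁))) := by
      rw [ae_restrict_neBot]
      simp [hab₁]
    obtain ⟨b, hb1, hb2⟩ := (h1.and h2).exists
    refine ⟨b, ⟨hb2.1, hb2.2.trans_le (min_le_left _ _)⟩, ?_, hb1⟩
    have h3 : b - a ≤ ε / (4 * (C + 1)) := by
      have := hb2.2.le.trans (min_le_right _ _)
      linarith
    calc C * (b - a) ≤ (C + 1) * (ε / (4 * (C + 1))) :=
          mul_le_mul (by linarith) h3 (by linarith [hb2.1]) (by linarith)
      _ = ε / 4 := by field_simp
  -- Since the value at `a` is minimal, `hlow` bounds the increment at `b` from below by an amount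
  -- of order `C * (b - a)`, so the sensitivity at `b` is small.
  have hD : |deriv (fun v => Y v b) x| ≤ C * (b - a) := by
    refine abs_deriv_le_of_lower_bound hbd.hasDerivAt fun v => ?_
    have h1 := (abs_le.1 (hbound v b hb.1.le)).1
    have h2 := hlow v b ⟨hb.1, hb.2.le⟩
    linarith
  have e1 := (hasDerivAt_iff_isLittleO.1 hdt.hasDerivAt).def (show 0 < ε / 4 by positivity)
  have e2 := (hasDerivAt_iff_isLittleO.1 hbd.hasDerivAt).def (show 0 < ε / 4 by positivity)
  obtain ⟨m, hm, hmin'⟩ : ∃ m > 0, ∀ s ∈ Icc b t, m ≤ Y x s := by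
    have hcont : ContinuousOn (Y x) (Icc b t) :=
      (hR _).continuousOn_Icc (ha.trans hb.1.le) ht
    obtain ⟨s, hs, hs'⟩ := isCompact_Icc.exists_isMinOn (nonempty_Icc.2 hb.2.le) hcont
    refine ⟨Y x s, ?_, fun s' h => hs' h⟩
    rw [hYx]
    exact hpos s ⟨hb.1.trans_le hs.1, hs.2⟩
  -- For such `v` the perturbed uncertainty stays positive on `[b, t]`, so there it follows its
  -- drift exactly.
  have e3 : ∀ᶠ v in 𝓝 x, C' * |v - x| < m := by
    have : Tendsto (fun v => C' * |v - x|) (𝓝 x) (𝓝 (C' * |x - x|)) :=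
      Continuous.tendsto (by fun_prop) x
    refine this.eventually_lt_const ?_
    simpa using hm
  filter_upwards [e1, e2, e3] with v e1 e2 e3
  have hv : ∫ s in b..t, f v s = Y v t - Y v b := by
    refine (hR _).integral_drift_eq (ha.trans hb.1.le) hb.2.le ht fun s hs => ?_
    have h1 := hunc v x s ⟨(ha.trans hb.1.le).trans hs.1.le, hs.2.le.trans ht⟩
    have h2 := hmin' s ⟨hs.1.le, hs.2.le⟩
    have h3 := (abs_le.1 h1).1
    change 0 < Y v s
    change _ ≤ Y v s - Y x s at h3
    linarith
  have hxx : ∫ s in b..t, f x s = Y x t - Y x b := by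
    refine (hR _).integral_drift_eq (ha.trans hb.1.le) hb.2.le ht fun s hs => ?_
    exact hm.trans_le (hmin' s ⟨hs.1.le, hs.2.le⟩)
  have hsplit : ∀ v, ∫ s in a..t, f v s = (∫ s in a..b, f v s) + ∫ s in b..t, f v s := fun v =>
    (intervalIntegral.integral_add_adjacent_intervals (hfi _ _ _) (hfi _ _ _)).symm
  have hlt := hlow v t ⟨hat, le_rfl⟩
  have hb1 := abs_le.1 (hbound v b hb.1.le)
  simp only [Real.norm_eq_abs, smul_eq_mul] at e1 e2 ⊢
  have e1 := abs_le.1 e1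
  have e2 := abs_le.1 e2
  have h0 := abs_nonneg (v - x)
  have h1 : C * |v - x| * (b - a) ≤ ε / 4 * |v - x| := by
    rw [mul_right_comm]; exact mul_le_mul_of_nonneg_right hbC h0
  have h2 : |(v - x) * deriv (fun v => Y v b) x| ≤ ε / 4 * |v - x| := by
    rw [abs_mul, mul_comm]
    exact mul_le_mul_of_nonneg_right (hD.trans hbC) h0
  have h2 := abs_le.1 h2
  rw [hsplit v, hsplit x, hv, hxx] at hlt
  change |(∫ s in a..t, f v s) - (∫ s in a..t, f x s) - _| ≤ _
  rw [hsplit v, hsplit x, hv, hxx, abs_le]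
  change -(ε / 4 * |v - x|) ≤ Y v t - Y x t - _ ∧ Y v t - Y x t - _ ≤ _ at e1
  change -(ε / 4 * |v - x|) ≤ Y v b - Y x b - _ ∧ Y v b - Y x b - _ ≤ _ at e2
  -- Four errors of ε/4: the integral over `[a, b]`, the linearizations at `t` and at `b`, and the
  -- derivative at `b`.
  constructor <;> linarith [e1.1, e1.2, e2.1, e2.2, h2.1, h2.2, hb1.1, hb1.2]

/-- A weight that vanishes while target `i` is within the range of the agent does not contribute. -/
theorem hasDerivAt_integral_detect_mul (W : World N M) (j : Fin N) (p : Plan) (c : Param)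
    (i : Fin M) {t : ℝ} {w : ℝ → ℝ}
    (hw : AEStronglyMeasurable w volume) (hw1 : ∀ s, |w s| ≤ 1)
    (h0 : ∀ᵐ s, s ∈ uIoc 0 t → |W.x i - p.position s| ≤ W.r j → w s = 0) :
    HasDerivAt (fun v => ∫ s in (0 : ℝ)..t, detect W i j ((p.withValue c v).position s) * w s)
      0 (p.value c) := by
  obtain ⟨C, hC, h⟩ := p.exists_abs_position_withValue_sub_le c
  have hr := W.r_pos j
  have hmeas : ∀ v, AEStronglyMeasurable
      (fun s => detect W i j ((p.withValue c v).position s) * w s) volume := fun v =>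
    ((continuous_detect W i j).comp
      (p.withValue c v).continuous_position).aestronglyMeasurable.mul hw
  have key := intervalIntegral.hasDerivAt_integral_of_dominated_loc_of_lip (μ := volume)
    (F := fun v s => detect W i j ((p.withValue c v).position s) * w s) (F' := fun _ => (0 : ℝ))
    (x₀ := p.value c) (s := univ) (a := 0) (b := t) (bound := fun _ => C / W.r j) univ_mem
    (Filter.Eventually.of_forall fun v => (hmeas v).restrict) ?_ aestronglyMeasurable_const ?_
    intervalIntegrable_const ?_
  · simpa using key.2
  · refine (intervalIntegrable_const (c := (1 : ℝ))).mono_fun (hmeas _).restrict ?_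
    refine Filter.Eventually.of_forall fun s => ?_
    beta_reduce
    rw [norm_mul, norm_one]
    refine mul_le_one₀ ?_ (norm_nonneg _) (hw1 s)
    rw [Real.norm_eq_abs, abs_of_nonneg (detect_nonneg W i j _)]
    exact detect_le_one W i j _
  · refine Filter.Eventually.of_forall fun s _ => LipschitzOnWith.of_dist_le_mul fun v _ v' _ => ?_
    rw [Real.dist_eq, Real.dist_eq, ← sub_mul, abs_mul]
    have h1 := (abs_detect_sub_le W i j ((p.withValue c v).position s)
      ((p.withValue c v').position s)).trans (div_le_div_of_nonneg_right (h v v' s) hr.le)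
    simp only [Real.coe_nnabs]
    rw [abs_of_nonneg (div_nonneg hC hr.le)]
    calc _ ≤ (C * |v - v'| / W.r j) * 1 :=
          mul_le_mul h1 (hw1 s) (abs_nonneg _) (by positivity)
      _ = _ := by ring
  · filter_upwards [h0] with s h0 hs
    -- In range the weight is zero for every `v`. Out of range is an open condition, so the
    -- detection probability vanishes for all `v` near the actual value.
    by_cases hin : |W.x i - p.position s| ≤ W.r j
    · simp only [h0 hs hin, mul_zero]
      exact hasDerivAt_const _ _
    · push Not at hin
      refine (hasDerivAt_const (p.value c) (0 : ℝ)).congr_of_eventuallyEq ?_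
      have hcont : ContinuousAt (fun v => (p.withValue c v).position s) (p.value c) := by
        refine (LipschitzWith.of_dist_le_mul (K := Real.toNNReal C)
          fun v v' => ?_).continuous.continuousAt
        rw [Real.coe_toNNReal _ hC]
        exact h v v' s
      have hcont' : ContinuousAt (fun v => |W.x i - (p.withValue c v).position s|) (p.value c) :=
        (continuousAt_const.sub hcont).abs
      have := hcont'.eventually_const_lt (u := W.r j) (by simpa using hin)
      filter_upwards [this] with v hv
      rw [detect_eq_zero W hv.le, zero_mul]

end

/-! One-sided neighborhoods in the real line. -/

theorem eventually_nhdsGT_nhdsGT {P : ℝ → Prop} {b : ℝ} (h : ∀ᶠ t in 𝓝[>] b, P t) :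
    ∀ᶠ s in 𝓝[>] b, ∀ᶠ t in 𝓝[>] s, P t := by
  obtain ⟨u, hu, hP⟩ := mem_nhdsGT_iff_exists_Ioo_subset.1 h
  filter_upwards [Ioo_mem_nhdsGT hu] with s hs
  filter_upwards [Ioo_mem_nhdsGT hs.2] with t ht
  exact hP ⟨hs.1.trans ht.1, ht.2⟩

theorem eventually_nhdsGT_forall_Ioc {P : ℝ → Prop} {b : ℝ} (h : ∀ᶠ t in 𝓝[>] b, P t) :
    ∀ᶠ s in 𝓝[>] b, ∀ t ∈ Ioc b s, P t := by
  obtain ⟨u, hu, hP⟩ := mem_nhdsGT_iff_exists_Ioo_subset.1 h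
  filter_upwards [Ioo_mem_nhdsGT hu] with s hs t ht
  exact hP ⟨ht.1, ht.2.trans_lt hs.2⟩

theorem eventually_nhdsLT_forall_Ico {P : ℝ → Prop} {b : ℝ} (h : ∀ᶠ t in 𝓝[<] b, P t) :
    ∀ᶠ s in 𝓝[<] b, ∀ t ∈ Ico s b, P t := by
  obtain ⟨u, hu, hP⟩ := mem_nhdsLT_iff_exists_Ioo_subset.1 h
  filter_upwards [Ioo_mem_nhdsLT hu] with s hs t ht
  exact hP ⟨hs.1.trans_le ht.1, ht.2⟩

theorem _root_.Set.OrdConnected.eventually_nhdsGT {s : Set ℝ} (hs : s.OrdConnected) (b : ℝ) :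
    (∀ᶠ t in 𝓝[>] b, t ∈ s) ∨ ∀ᶠ t in 𝓝[>] b, t ∉ s := by
  by_contra! h
  obtain ⟨h1, h2⟩ := h
  obtain ⟨u, hu, hub⟩ := (h2.and_eventually self_mem_nhdsWithin).exists
  obtain ⟨v, hv, hvu⟩ := (h1.and_eventually (Ioo_mem_nhdsGT hub)).exists
  obtain ⟨w, hw, hwv⟩ := (h2.and_eventually (Ioo_mem_nhdsGT hvu.1)).exists
  exact hv (hs.out hw hu ⟨hwv.2.le, hvu.2.le⟩)

theorem _root_.Set.OrdConnected.eventually_nhdsLT {s : Set ℝ} (hs : s.OrdConnected) (b : ℝ) :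
    (∀ᶠ t in 𝓝[<] b, t ∈ s) ∨ ∀ᶠ t in 𝓝[<] b, t ∉ s := by
  by_contra! h
  obtain ⟨h1, h2⟩ := h
  obtain ⟨u, hu, hub⟩ := (h2.and_eventually self_mem_nhdsWithin).exists
  obtain ⟨v, hv, hvu⟩ := (h1.and_eventually (Ioo_mem_nhdsLT hub)).exists
  obtain ⟨w, hw, hwv⟩ := (h2.and_eventually (Ioo_mem_nhdsLT hvu.2)).exists
  exact hv (hs.out hu hw ⟨hvu.1.le, hwv.1.le⟩)

/-- Induction along a time interval. -/
theorem forall_Ico_of_forward_induction {P : ℝ → Prop} {T : ℝ}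
    (h1 : ∀ b ∈ Ico 0 T, (∀ s ∈ Ico 0 b, P s) → P b)
    (h2 : ∀ b ∈ Ico 0 T, P b → ∀ᶠ s in 𝓝[>] b, P s) : ∀ s ∈ Ico 0 T, P s := by
  by_contra! h
  obtain ⟨s, hs, hPs⟩ := h
  set B : Set ℝ := {s | s ∈ Ico 0 T ∧ ¬ P s} with hB
  have hne : B.Nonempty := ⟨s, hs, hPs⟩
  have hbdd : BddBelow B := ⟨0, fun u hu => hu.1.1⟩
  have hb : sInf B ∈ Ico 0 T :=
    ⟨le_csInf hne fun u hu => hu.1.1, (csInf_le hbdd ⟨hs, hPs⟩).trans_lt hs.2⟩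
  have hlt : ∀ u ∈ Ico 0 (sInf B), P u := by
    intro u hu
    by_contra hu'
    exact (csInf_le hbdd ⟨⟨hu.1, hu.2.trans hb.2⟩, hu'⟩).not_gt hu.2
  -- The infimum of the failures satisfies `P`, so failures accumulate at it from the right, against
  -- `h2`.
  have hPb := h1 _ hb hlt
  obtain ⟨u, hu, hPu⟩ := mem_nhdsGT_iff_exists_Ioo_subset.1 (h2 _ hb hPb)
  obtain ⟨v, hv, hvu⟩ := exists_lt_of_csInf_lt hne hu
  rcases (csInf_le hbdd hv).eq_or_lt with h | h
  · exact hv.2 (h ▸ hPb)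
  · exact hv.2 (hPu ⟨h, hvu⟩)

/-! Local structure of the trajectories. -/

/-- Target `i` is within the range of agent `k` at time `t`. -/
def InRange (W : World N M) (S : Scenario N M) (i : Fin M) (k : Fin N) (t : ℝ) : Prop :=
  |W.x i - S.pos k t| ≤ W.r k

theorem mem_targetNbhd {W : World N M} {S : Scenario N M} {i : Fin M} {j : Fin N} {t : ℝ} :
    i ∈ targetNbhd W S j t ↔ InRange W S i j t := Iff.rfl

theorem mem_collaborators {W : World N M} {S : Scenario N M} {i : Fin M} {j k : Fin N} {t : ℝ} :
    k ∈ collaborators W S i j t ↔ InRange W S i k t ∧ k ≠ j := by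
  rw [InRange, abs_sub_comm]; rfl

section

variable {W : World N M} {S S' : Scenario N M} {R R' : Fin M → ℝ → ℝ} {i : Fin M} {j k : Fin N}
  {s t τ : ℝ}

theorem Scenario.Feasible.exists_ctrl_eq (hS : S.Feasible W) (k : Fin N) (t : ℝ) :
    ∃ a : SignType, S.ctrl k t = (a : ℝ) :=
  (S.plan k).exists_control_eq (hS.dwell_nonneg k) t

theorem Scenario.Feasible.exists_ctrl_right (hS : S.Feasible W) (k : Fin N) (τ : ℝ) :
    ∃ a : SignType, S.ctrl k τ = (a : ℝ) ∧ ∀ᶠ t in 𝓝[>] τ, S.ctrl k t = (a : ℝ) := by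
  obtain ⟨a, ha⟩ := hS.exists_ctrl_eq k τ
  refine ⟨a, ha, ?_⟩
  filter_upwards [(S.plan k).eventually_control_right τ] with t ht
  exact ht.trans ha

theorem Scenario.Feasible.exists_ctrl_left (hS : S.Feasible W) (k : Fin N) (τ : ℝ) :
    ∃ a : SignType, ∀ᶠ t in 𝓝[<] τ, S.ctrl k t = (a : ℝ) := by
  obtain ⟨s, hs⟩ := (S.plan k).exists_eventually_control_left τ
  obtain ⟨a, ha⟩ := hS.exists_ctrl_eq k s
  exact ⟨a, hs.mono fun t ht => Eq.trans ht ha⟩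

theorem eventually_pos_right {a : ℝ} (h : ∀ᶠ t in 𝓝[>] τ, S.ctrl k t = a) :
    ∀ᶠ t in 𝓝[>] τ, S.pos k t = S.pos k τ + a * (t - τ) := by
  filter_upwards [eventually_nhdsGT_forall_Ioc h, self_mem_nhdsWithin] with t ht hτ
  exact (S.plan k).position_eq_of_control_eq (le_of_lt hτ) fun s hs => ht s ⟨hs.1, hs.2.le⟩

theorem eventually_pos_left {a : ℝ} (h : ∀ᶠ t in 𝓝[<] τ, S.ctrl k t = a) :
    ∀ᶠ t in 𝓝[<] τ, S.pos k t = S.pos k τ + a * (t - τ) := by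
  filter_upwards [eventually_nhdsLT_forall_Ico h, self_mem_nhdsWithin] with t ht hτ
  have : S.pos k τ = S.pos k t + a * (τ - t) :=
    (S.plan k).position_eq_of_control_eq (le_of_lt hτ) fun s hs => ht s ⟨hs.1.le, hs.2⟩
  linarith

theorem ordConnected_abs_sub_affine_le (x r y τ : ℝ) (a : SignType) :
    {t : ℝ | |x - (y + (a : ℝ) * (t - τ))| ≤ r}.OrdConnected := by
  refine ⟨fun u hu v hv w hw => ?_⟩
  simp only [mem_ofPred_eq, abs_le] at *
  cases a <;> simp at * <;> constructor <;> linarith [hu.1, hu.2, hv.1, hv.2, hw.1, hw.2]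

/-- The motion is affine just after τ, so the times in range form an interval there and cannot
alternate. -/
theorem Scenario.Feasible.eventually_inRange_right (hS : S.Feasible W) (i : Fin M) (k : Fin N)
    (τ : ℝ) : (∀ᶠ t in 𝓝[>] τ, InRange W S i k t) ∨ ∀ᶠ t in 𝓝[>] τ, ¬ InRange W S i k t := by
  obtain ⟨a, -, ha⟩ := hS.exists_ctrl_right k τ
  have hp := eventually_pos_right ha
  refine ((ordConnected_abs_sub_affine_le (W.x i) (W.r k) (S.pos k τ) τ a).eventually_nhdsGT
    τ).imp ?_ ?_ <;>
  · intro h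
    filter_upwards [h, hp] with t h1 h2
    rw [InRange, h2]
    exact h1

theorem Scenario.Feasible.eventually_inRange_left (hS : S.Feasible W) (i : Fin M) (k : Fin N)
    (τ : ℝ) : (∀ᶠ t in 𝓝[<] τ, InRange W S i k t) ∨ ∀ᶠ t in 𝓝[<] τ, ¬ InRange W S i k t := by
  obtain ⟨a, ha⟩ := hS.exists_ctrl_left k τ
  have hp := eventually_pos_left ha
  refine ((ordConnected_abs_sub_affine_le (W.x i) (W.r k) (S.pos k τ) τ a).eventually_nhdsLT
    τ).imp ?_ ?_ <;>
  · intro h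
    filter_upwards [h, hp] with t h1 h2
    rw [InRange, h2]
    exact h1

theorem continuous_distance (W : World N M) (S : Scenario N M) (i : Fin M) (k : Fin N) :
    Continuous fun t => |W.x i - S.pos k t| :=
  (continuous_const.sub (S.continuous_pos k)).abs

theorem inRange_of_eventually_right (h : ∀ᶠ t in 𝓝[>] τ, InRange W S i k t) :
    InRange W S i k τ :=
  le_of_tendsto ((continuous_distance W S i k).continuousWithinAt (s := Ioi τ)) h

theorem range_le_of_eventually_not_right (h : ∀ᶠ t in 𝓝[>] τ, ¬ InRange W S i k t) :
    W.r k ≤ |W.x i - S.pos k τ| :=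
  ge_of_tendsto ((continuous_distance W S i k).continuousWithinAt (s := Ioi τ))
    (h.mono fun _ ht => (not_le.1 ht).le)

theorem range_le_of_eventually_not_left (h : ∀ᶠ t in 𝓝[<] τ, ¬ InRange W S i k t) :
    W.r k ≤ |W.x i - S.pos k τ| :=
  ge_of_tendsto ((continuous_distance W S i k).continuousWithinAt (s := Iio τ))
    (h.mono fun _ ht => (not_le.1 ht).le)

/-! Times at which agent `j` reads off states. -/

/-- Agent `j` obtains local readings at time `τ`. -/
def ReadsAt (W : World N M) (S : Scenario N M) (R : Fin M → ℝ → ℝ) (j : Fin N) (τ : ℝ) : Prop :=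
  τ = 0 ∨ τ ∈ Ioo 0 W.T ∧ ∃ e ∈ localInfo W S j τ, Occurs W S R τ e

theorem targetEvents_subset_localEvents (h : InRange W S i j τ) :
    targetEvents i ⊆ localEvents W S j τ := fun _ he =>
  Or.inr (mem_biUnion (mem_targetNbhd.2 h) he)

theorem readsAt_of_switch (hτ : τ ∈ Ioo 0 W.T) {a b : SignType} (hab : a ≠ b)
    (ha : ∀ᶠ t in 𝓝[<] τ, S.ctrl j t = (a : ℝ)) (hb : ∀ᶠ t in 𝓝[>] τ, S.ctrl j t = (b : ℝ)) :
    ReadsAt W S R j τ :=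
  Or.inr ⟨hτ, .nu j a b, Or.inl (Or.inl ⟨a, b, rfl⟩), hab, ha, hb⟩

theorem readsAt_of_collaborator_switch (hτ : τ ∈ Ioo 0 W.T) (hj : InRange W S i j τ)
    (hk : InRange W S i k τ) (hkj : k ≠ j) {a b : SignType} (hab : a ≠ b)
    (ha : ∀ᶠ t in 𝓝[<] τ, S.ctrl k t = (a : ℝ)) (hb : ∀ᶠ t in 𝓝[>] τ, S.ctrl k t = (b : ℝ)) :
    ReadsAt W S R j τ :=
  Or.inr ⟨hτ, .nu k a b, Or.inr (mem_biUnion (mem_targetNbhd.2 hj)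
    (mem_biUnion (mem_collaborators.2 ⟨hk, hkj⟩) (Or.inl ⟨a, b, rfl⟩))), hab, ha, hb⟩

theorem readsAt_of_join (hτ : τ ∈ Ioo 0 W.T) (hj : InRange W S i j τ) (hkj : k ≠ j)
    (hl : ∀ᶠ t in 𝓝[<] τ, ¬ InRange W S i k t) (hr : ∀ᶠ t in 𝓝[>] τ, InRange W S i k t) :
    ReadsAt W S R j τ := by
  refine Or.inr ⟨hτ, .deltaPlus i j, Or.inl (targetEvents_subset_localEvents hj ?_), k, ?_, ?_⟩
  · exact Or.inr (Or.inr ⟨j, Or.inr (Or.inr (Or.inl rfl))⟩)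
  · exact hl.mono fun t ht h => ht (mem_collaborators.1 h).1
  · exact hr.mono fun t ht => mem_collaborators.2 ⟨ht, hkj⟩

/-- Out of range before reaching the boundary and with unchanged control, the agent is heading
inward. The bounds by `r` prevent it from having traversed the whole range. -/
theorem abs_sub_lt_of_lt_abs_add {y r h h' : ℝ} (a : SignType) (hy : |y| = r) (hh : h ∈ Ioo 0 r)
    (hh' : h' ∈ Ioo 0 r) (hr : r < |y + (a : ℝ) * h|) : |y - (a : ℝ) * h'| < r := by
  obtain ⟨h1, h2⟩ := hh
  obtain ⟨h3, h4⟩ := hh'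
  have hy' : y = r ∨ y = -r := by
    rcases abs_cases y with h | h
    · left; linarith
    · right; linarith
  cases a <;> rcases hy' with rfl | rfl <;> rcases lt_abs.1 hr with h5 | h5 <;> simp at h5 ⊢ <;>
    (rw [abs_lt]; constructor <;> linarith)

/-- An agent whose sensing range a target enters obtains readings: either it starts to detect the
target, or it changes its control. -/
theorem readsAt_of_enter (hS : S.Feasible W) (hτ : τ ∈ Ioo 0 W.T)
    (hl : ∀ᶠ t in 𝓝[<] τ, ¬ InRange W S i j t) (hr : ∀ᶠ t in 𝓝[>] τ, InRange W S i j t) :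
    ReadsAt W S R j τ := by
  obtain ⟨a, ha⟩ := hS.exists_ctrl_left j τ
  obtain ⟨b, -, hb⟩ := hS.exists_ctrl_right j τ
  by_cases hab : a = b
  swap
  · exact readsAt_of_switch hτ hab ha hb
  subst hab
  have hin := inRange_of_eventually_right hr
  have hy : |W.x i - S.pos j τ| = W.r j := le_antisymm hin (range_le_of_eventually_not_left hl)
  refine Or.inr ⟨hτ, .piPlus i j, Or.inl (targetEvents_subset_localEvents hin ?_),
    detect_eq_zero W hy.ge, ?_⟩
  · exact Or.inr (Or.inr ⟨j, Or.inr (Or.inl rfl)⟩)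
  have hpos := W.r_pos j
  have hl2 := eventually_pos_left ha
  have hr2 := eventually_pos_right hb
  obtain ⟨u, ⟨hu, hu2⟩, hu3⟩ := ((hl.and hl2).and
    (Ioo_mem_nhdsLT (show τ - W.r j < τ by linarith))).exists
  rw [InRange, hu2, not_le] at hu
  filter_upwards [hr2, Ioo_mem_nhdsGT (show τ < τ + W.r j by linarith)] with t ht htr
  refine detect_pos W ?_
  rw [ht]
  have := abs_sub_lt_of_lt_abs_add a hy (show τ - u ∈ Ioo 0 (W.r j) from
    ⟨by linarith [hu3.2], by linarith [hu3.1]⟩) (show t - τ ∈ Ioo 0 (W.r j) from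
    ⟨by linarith [htr.1], by linarith [htr.2]⟩) (by
      rwa [show W.x i - S.pos j τ + (a : ℝ) * (τ - u) =
        W.x i - (S.pos j τ + (a : ℝ) * (u - τ)) by ring])
  rwa [sub_sub] at this

/-! What agent `j` can infer. -/

/-- Two scenarios that agent `j` cannot tell apart. -/
structure Indistinguishable (W : World N M) (S S' : Scenario N M) (R R' : Fin M → ℝ → ℝ)
    (j : Fin N) : Prop where
  feasible : S.Feasible W
  feasible' : S'.Feasible W
  uncertainty : IsUncertainty W S R
  uncertainty' : IsUncertainty W S' R'
  plan_eq : S.plan j = S'.plan j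
  observe_eq : observe W S R j = observe W S' R' j

namespace Indistinguishable

theorem symm (h : Indistinguishable W S S' R R' j) : Indistinguishable W S' S R' R j :=
  ⟨h.feasible', h.feasible, h.uncertainty', h.uncertainty, h.plan_eq.symm, h.observe_eq.symm⟩

theorem inRange_iff (h : Indistinguishable W S S' R R' j) (i : Fin M) (t : ℝ) :
    InRange W S i j t ↔ InRange W S' i j t := by
  rw [InRange, InRange, Scenario.pos, Scenario.pos, h.plan_eq]

theorem uncertainty_eq_of_readsAt (h : Indistinguishable W S S' R R' j)
    (hτ : ReadsAt W S R j τ) (hi : InRange W S i j τ) : R i τ = R' i τ := by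
  have h1 : (τ, Reading.uncertainty i (R i τ)) ∈ (observe W S R j).readings :=
    ⟨hτ, i, hi, Or.inl rfl⟩
  rw [h.observe_eq] at h1
  obtain ⟨-, i', -, h2 | ⟨k, -, h2 | h2⟩⟩ := h1
  · simp only [Reading.uncertainty.injEq] at h2
    obtain ⟨rfl, h2⟩ := h2
    exact h2
  · simp at h2
  · simp at h2

theorem agent_eq_of_readsAt (h : Indistinguishable W S S' R R' j)
    (hτ : ReadsAt W S R j τ) (hi : InRange W S i j τ) (hk : InRange W S i k τ) (hkj : k ≠ j) :
    S.pos k τ = S'.pos k τ ∧ S.ctrl k τ = S'.ctrl k τ := by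
  constructor
  · have h1 : (τ, Reading.position k (S.pos k τ)) ∈ (observe W S R j).readings :=
      ⟨hτ, i, hi, Or.inr ⟨k, mem_collaborators.2 ⟨hk, hkj⟩, Or.inl rfl⟩⟩
    rw [h.observe_eq] at h1
    obtain ⟨-, i', -, h2 | ⟨k', -, h2 | h2⟩⟩ := h1
    · simp at h2
    · simp only [Reading.position.injEq] at h2
      obtain ⟨rfl, h2⟩ := h2
      exact h2
    · simp at h2
  · have h1 : (τ, Reading.control k (S.ctrl k τ)) ∈ (observe W S R j).readings :=
      ⟨hτ, i, hi, Or.inr ⟨k, mem_collaborators.2 ⟨hk, hkj⟩, Or.inr rfl⟩⟩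
    rw [h.observe_eq] at h1
    obtain ⟨-, i', -, h2 | ⟨k', -, h2 | h2⟩⟩ := h1
    · simp at h2
    · simp at h2
    · simp only [Reading.control.injEq] at h2
      obtain ⟨rfl, h2⟩ := h2
      exact h2

/-- A depletion is observed in any case: as a target event in range, as a remote depletion
otherwise. -/
theorem hitsZero (h : Indistinguishable W S S' R R' j) (hτ : τ ∈ Ioo 0 W.T)
    (hz : HitsZero (R i) τ) : HitsZero (R' i) τ := by
  have h1 : (τ, Event.rhoZero i) ∈ (observe W S R j).events := by
    refine ⟨hτ, hz, ?_⟩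
    by_cases hi : InRange W S i j τ
    · exact Or.inl (Or.inl (targetEvents_subset_localEvents hi (Or.inl rfl)))
    · exact Or.inr ⟨i, hi, rfl⟩
  rw [h.observe_eq] at h1
  exact h1.2.1

/-- The state of a collaborator is known as long as it shares a target. -/
theorem agent_eq (h : Indistinguishable W S S' R R' j) (hkj : k ≠ j) (hs : s ∈ Ico 0 W.T)
    (hj : ∀ᶠ t in 𝓝[>] s, InRange W S i j t) (hk : ∀ᶠ t in 𝓝[>] s, InRange W S i k t) :
    S.pos k s = S'.pos k s ∧ S.ctrl k s = S'.ctrl k s := by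
  refine forall_Ico_of_forward_induction (P := fun s => (∀ᶠ t in 𝓝[>] s, InRange W S i j t) →
    (∀ᶠ t in 𝓝[>] s, InRange W S i k t) → S.pos k s = S'.pos k s ∧ S.ctrl k s = S'.ctrl k s)
    ?_ ?_ s hs hj hk
  · intro b hb ih hj hk
    have hjb := inRange_of_eventually_right hj
    have hkb := inRange_of_eventually_right hk
    -- At `b` there is a reading if `b = 0`, if `j` comes into range, if `k` joins, or if `k`
    -- switches. Otherwise knowledge at a slightly earlier time is carried to `b` by uniform motion.
    rcases hb.1.eq_or_lt with hb0 | hb0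
    · exact h.agent_eq_of_readsAt (Or.inl hb0.symm) hjb hkb hkj
    have hb' : b ∈ Ioo 0 W.T := ⟨hb0, hb.2⟩
    rcases h.feasible.eventually_inRange_left i j b with hjl | hjl
    swap
    · exact h.agent_eq_of_readsAt (readsAt_of_enter h.feasible hb' hjl hj) hjb hkb hkj
    rcases h.feasible.eventually_inRange_left i k b with hkl | hkl
    swap
    · exact h.agent_eq_of_readsAt (readsAt_of_join hb' hjb hkj hkl hk) hjb hkb hkj
    obtain ⟨a, ha⟩ := h.feasible.exists_ctrl_left k b
    obtain ⟨a', ha'⟩ := h.feasible'.exists_ctrl_left k b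
    obtain ⟨e, hbe, he⟩ := h.feasible.exists_ctrl_right k b
    obtain ⟨e', hbe', he'⟩ := h.feasible'.exists_ctrl_right k b
    obtain ⟨s, hs, hsb⟩ := ((eventually_nhdsLT_forall_Ico
      ((hjl.and hkl).and (ha.and ha'))).and (Ioo_mem_nhdsLT hb0)).exists
    have hright : ∀ᶠ t in 𝓝[>] s, t ∈ Ico s b := Ico_mem_nhdsGT hsb.2
    obtain ⟨hp, hc⟩ := ih s ⟨hsb.1.le, hsb.2⟩ (hright.mono fun t ht => (hs t ht).1.1)
      (hright.mono fun t ht => (hs t ht).1.2)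
    have hss := (hs s ⟨le_rfl, hsb.2⟩).2
    have haa : (a : ℝ) = a' := hss.1.symm.trans (hc.trans hss.2)
    have hpb : S.pos k b = S'.pos k b := by
      have h1 : S.pos k b = S.pos k s + (a : ℝ) * (b - s) :=
        (S.plan k).position_eq_of_control_eq hsb.2.le fun t ht => (hs t ⟨ht.1.le, ht.2⟩).2.1
      have h2 : S'.pos k b = S'.pos k s + (a' : ℝ) * (b - s) :=
        (S'.plan k).position_eq_of_control_eq hsb.2.le fun t ht => (hs t ⟨ht.1.le, ht.2⟩).2.2
      rw [h1, h2, hp, haa]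
    by_cases hae : a = e
    swap
    · exact h.agent_eq_of_readsAt
        (readsAt_of_collaborator_switch hb' hjb hkb hkj hae ha he) hjb hkb hkj
    by_cases hae' : a' = e'
    swap
    -- A switch in the second scenario only: by continuity the positions at `b` agree, so `k` is in
    -- range there too and the reading made in that scenario applies.
    · have hjb' := (h.inRange_iff i b).1 hjb
      have hkb' : InRange W S' i k b := by rwa [InRange, ← hpb]
      have := h.symm.agent_eq_of_readsAt
        (readsAt_of_collaborator_switch hb' hjb' hkb' hkj hae' ha' he') hjb' hkb' hkj
      exact ⟨hpb, this.2.symm⟩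
    refine ⟨hpb, ?_⟩
    rw [hbe, hbe', ← hae, ← hae', haa]
  · intro b hb hP
    rcases h.feasible.eventually_inRange_right i j b with hj | hj
    swap
    -- Vacuous: the target is out of range at all times shortly after `b`.
    · filter_upwards [eventually_nhdsGT_nhdsGT hj] with s hs hs'
      obtain ⟨t, ht, ht'⟩ := (hs.and hs').exists
      exact absurd ht' ht
    rcases h.feasible.eventually_inRange_right i k b with hk | hk
    swap
    · filter_upwards [eventually_nhdsGT_nhdsGT hk] with s hs _ hs'
      obtain ⟨t, ht, ht'⟩ := (hs.and hs').exists
      exact absurd ht' ht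
    obtain ⟨hp, hc⟩ := hP hj hk
    obtain ⟨e, hbe, he⟩ := h.feasible.exists_ctrl_right k b
    obtain ⟨e', hbe', he'⟩ := h.feasible'.exists_ctrl_right k b
    filter_upwards [he, he', eventually_pos_right he, eventually_pos_right he']
      with s h1 h2 h3 h4 _ _
    have hee : (e : ℝ) = e' := hbe.symm.trans (hc.trans hbe')
    exact ⟨by rw [h3, h4, hp, hee], by rw [h1, h2, hee]⟩

/-- An agent sensing the target just after `s` in either scenario has a known position. One sensing
it in neither is at distance at least its range at `s`, and its factor is 1. -/
theorem missByOthers_eq (h : Indistinguishable W S S' R R' j) (hs : s ∈ Ico 0 W.T)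
    (hj : ∀ᶠ t in 𝓝[>] s, InRange W S i j t) :
    missByOthers W S j i s = missByOthers W S' j i s := by
  refine Finset.prod_congr rfl fun k hk => ?_
  have hkj := Finset.ne_of_mem_erase hk
  rcases h.feasible.eventually_inRange_right i k s with hk | hk
  · rw [(h.agent_eq hkj hs hj hk).1]
  rcases h.feasible'.eventually_inRange_right i k s with hk' | hk'
  · rw [(h.symm.agent_eq hkj hs (hj.mono fun t ht => (h.inRange_iff i t).1 ht) hk').1]
  · rw [detect_eq_zero W (range_le_of_eventually_not_right hk),
      detect_eq_zero W (range_le_of_eventually_not_right hk')]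

theorem drift_eq (h : Indistinguishable W S S' R R' j) (hs : s ∈ Ico 0 W.T)
    (hj : ∀ᶠ t in 𝓝[>] s, InRange W S i j t) : drift W S i s = drift W S' i s := by
  rw [drift, drift, jointDetect_eq W S j, jointDetect_eq W S' j, h.missByOthers_eq hs hj,
    Scenario.pos, Scenario.pos, h.plan_eq]

/-- The uncertainties of the targets within range are known. -/
theorem uncertainty_eq (h : Indistinguishable W S S' R R' j) (hs : s ∈ Ico 0 W.T)
    (hj : ∀ᶠ t in 𝓝[>] s, InRange W S i j t) : R i s = R' i s := by
  refine forall_Ico_of_forward_induction (P := fun s => (∀ᶠ t in 𝓝[>] s, InRange W S i j t) →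
    R i s = R' i s) ?_ ?_ s hs hj
  · intro b hb ih hj
    have hjb := inRange_of_eventually_right hj
    rcases hb.1.eq_or_lt with hb0 | hb0
    · exact h.uncertainty_eq_of_readsAt (Or.inl hb0.symm) hjb
    rcases h.feasible.eventually_inRange_left i j b with hjl | hjl
    swap
    · exact h.uncertainty_eq_of_readsAt (readsAt_of_enter h.feasible ⟨hb0, hb.2⟩ hjl hj) hjb
    have hmem : Icc 0 W.T ∈ 𝓝 b := Icc_mem_nhds hb0 hb.2
    have h1 := ((h.uncertainty.cont i).continuousAt hmem).continuousWithinAt (s := Iio b)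
    have h2 := ((h.uncertainty'.cont i).continuousAt hmem).continuousWithinAt (s := Iio b)
    refine tendsto_nhds_unique_of_eventuallyEq h1 h2 ?_
    filter_upwards [eventually_nhdsLT_forall_Ico hjl, Ioo_mem_nhdsLT hb0] with s hs hsb
    refine ih s ⟨hsb.1.le, hsb.2⟩ ?_
    filter_upwards [Ico_mem_nhdsGT hsb.2] with t ht using hs t ht
  · intro b hb hP
    rcases h.feasible.eventually_inRange_right i j b with hj | hj
    swap
    · filter_upwards [eventually_nhdsGT_nhdsGT hj] with s hs hs'
      obtain ⟨t, ht, ht'⟩ := (hs.and hs').exists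
      exact absurd ht' ht
    filter_upwards [eventually_nhdsGT_forall_Ioc hj, Ioo_mem_nhdsGT hb.2] with s hs hsb _
    refine h.uncertainty.eq_of_drift_eq h.uncertainty' hb.1 hsb.2.le (hP hj) ?_ s ⟨hsb.1.le, le_rfl⟩
    intro u hu
    refine h.drift_eq ⟨hb.1.trans hu.1, hu.2.trans hsb.2⟩ ?_
    filter_upwards [Ioo_mem_nhdsGT hu.2] with t ht using hs t ⟨hu.1.trans_lt ht.1, ht.2.le⟩

/-- While target `i` is within range, it cannot be depleted in one of the scenarios only, even if
the depletion is not observed. -/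
theorem not_inRange_of_depleted (h : Indistinguishable W S S' R R' j) {a a' t : ℝ} (ha : 0 ≤ a)
    (hat : a' ≤ t) (ht : t < W.T) (hpos : ∀ s ∈ Ioc a t, 0 < R i s) (ha' : R' i a' = 0) :
    ∀ s ∈ Ioc a a', ¬ ∀ᶠ u in 𝓝[>] s, InRange W S i j u := by
  intro s hs hj
  have h0s : 0 < s := ha.trans_lt hs.1
  have h1 : 0 < R' i s := by
    rw [← h.uncertainty_eq ⟨h0s.le, (hs.2.trans hat).trans_lt ht⟩ hj]
    exact hpos s ⟨hs.1, hs.2.trans hat⟩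
  have hcont : ContinuousOn (R' i) (Icc s a') :=
    h.uncertainty'.continuousOn_Icc h0s.le (hat.trans ht.le)
  have hcomp : IsCompact (Icc s a' ∩ R' i ⁻¹' {0}) :=
    isCompact_Icc.of_isClosed_subset (hcont.preimage_isClosed_of_isClosed isClosed_Icc
      isClosed_singleton) inter_subset_left
  -- The first zero of `R' i` after `s` is a genuine depletion event, since `R' i s` is positive.
  obtain ⟨σ, ⟨hσ, hσ0⟩, hleast⟩ := hcomp.exists_isLeast ⟨a', ⟨hs.2, le_rfl⟩, ha'⟩
  have hσ0 : R' i σ = 0 := hσ0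
  have hsσ : s < σ := hσ.1.lt_of_ne fun h => by rw [h, hσ0] at h1; exact h1.false
  have hz : HitsZero (R' i) σ := by
    refine ⟨hσ0, ?_⟩
    filter_upwards [Ioo_mem_nhdsLT hsσ] with u hu
    refine lt_of_le_of_ne (h.uncertainty'.nonneg i u
      ⟨h0s.le.trans hu.1.le, (hu.2.le.trans (hσ.2.trans hat)).trans ht.le⟩) fun h0 => ?_
    exact (hleast ⟨⟨hu.1.le, hu.2.le.trans hσ.2⟩, h0.symm⟩).not_gt hu.2
  have hz' := h.symm.hitsZero ⟨h0s.trans hsσ, (hσ.2.trans hat).trans_lt ht⟩ hz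
  exact (hpos σ ⟨hs.1.trans hsσ, hσ.2.trans hat⟩).ne' hz'.1

end Indistinguishable

/-! ### Exceptional times and last zeros -/

/-- Inference at `s` needs the target in range just after `s`. The times in range where this fails
are isolated from the right among the times in range, hence countable. -/
theorem Scenario.Feasible.ae_eventually_inRange (hS : S.Feasible W) (i : Fin M) (j : Fin N) :
    ∀ᵐ s : ℝ, InRange W S i j s → ∀ᶠ t in 𝓝[>] s, InRange W S i j t := by
  have hc := countable_setOfPred_isolated_right_within (s := {t | InRange W S i j t})
  rw [ae_iff]
  refine (hc.mono fun s hs => ?_).measure_zero volume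
  simp only [mem_ofPred_eq, Classical.not_imp] at hs
  refine ⟨hs.1, ?_⟩
  have h := (hS.eventually_inRange_right i j s).resolve_left hs.2
  rw [inter_comm, nhdsWithin_inter', ← empty_mem_iff_bot]
  refine mem_inf_iff.2 ⟨{t | ¬ InRange W S i j t}, h, {t | InRange W S i j t},
    mem_principal_self _, ?_⟩
  ext t
  simp

theorem IsUncertainty.exists_last_zero (hR : IsUncertainty W S R) (i : Fin M) (ht : t ∈ Icc 0 W.T) :
    ∃ a ∈ Icc 0 t, (a = 0 ∨ R i a = 0) ∧ ∀ s ∈ Ioc a t, 0 < R i s := by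
  have hcont : ContinuousOn (R i) (Icc 0 t) := hR.continuousOn_Icc le_rfl ht.2
  -- Adjoining 0 makes the set nonempty and supplies the default when there is no zero.
  have hcomp : IsCompact (({0} : Set ℝ) ∪ (Icc 0 t ∩ R i ⁻¹' {0})) :=
    isCompact_singleton.union (isCompact_Icc.of_isClosed_subset
      (hcont.preimage_isClosed_of_isClosed isClosed_Icc isClosed_singleton) inter_subset_left)
  obtain ⟨a, hmem, hgreatest⟩ := hcomp.exists_isGreatest ⟨0, Or.inl rfl⟩
  have ha : a ∈ Icc 0 t := by
    rcases hmem with h | h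
    · rw [mem_singleton_iff.1 h]; exact ⟨le_rfl, ht.1⟩
    · exact h.1
  refine ⟨a, ha, hmem.imp id fun h => h.2, fun s hs => ?_⟩
  have hs0 : 0 ≤ s := ha.1.trans hs.1.le
  refine lt_of_le_of_ne (hR.nonneg i s ⟨hs0, hs.2.trans ht.2⟩) fun h0 => ?_
  exact (hgreatest (Or.inr ⟨⟨hs0, hs.2⟩, h0.symm⟩)).not_gt hs.1

end

/-! ### Comparison of sensitivities in two scenarios -/

/-- Only the last integral involves `p`. The indicator extends it to `[0, t]`, so that scenarios
with different last zeros can be compared over the same interval. -/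
theorem integral_drift_withPlan (W : World N M) (S : Scenario N M) (j : Fin N) (p : Plan)
    (i : Fin M) {a t : ℝ} (ha : 0 ≤ a) (hat : a ≤ t) :
    ∫ s in a..t, drift W (S.withPlan j p) i s =
      (∫ s in a..t, (W.A i - W.B i + W.B i * missByOthers W S j i s)) -
        W.B i * ∫ s in (0 : ℝ)..t, detect W i j (p.position s) *
          (Ioi a).indicator (missByOthers W S j i) s := by
  have hm := continuous_missByOthers W S j i
  have hd : Continuous fun s => detect W i j (p.position s) :=
    (continuous_detect W i j).comp p.continuous_position
  have h1 : ∫ s in (0 : ℝ)..t, detect W i j (p.position s) *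
      (Ioi a).indicator (missByOthers W S j i) s =
      ∫ s in a..t, detect W i j (p.position s) * missByOthers W S j i s := by
    have h2 : (fun s => detect W i j (p.position s) * (Ioi a).indicator (missByOthers W S j i) s) =
        (Ioi a).indicator (fun s => detect W i j (p.position s) * missByOthers W S j i s) := by
      ext s
      by_cases hs : s ∈ Ioi a <;> simp [hs]
    rw [h2, intervalIntegral.integral_of_le (ha.trans hat), intervalIntegral.integral_of_le hat,
      setIntegral_indicator measurableSet_Ioi]
    congr 2
    ext s
    simp only [mem_inter_iff, mem_Ioc, mem_Ioi]
    constructor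
    · rintro ⟨⟨_, h⟩, h'⟩; exact ⟨h', h⟩
    · rintro ⟨h', h⟩; exact ⟨⟨ha.trans_lt h', h⟩, h'⟩
  rw [h1, ← intervalIntegral.integral_const_mul, ← intervalIntegral.integral_sub]
  · refine intervalIntegral.integral_congr fun s _ => ?_
    simp only [drift_withPlan]
    ring
  · exact Continuous.intervalIntegrable (by fun_prop) _ _
  · exact Continuous.intervalIntegrable (by fun_prop) _ _

/-- In two scenarios that agent `j` cannot tell apart, the uncertainties have the same sensitivity
to its parameters. -/
theorem Indistinguishable.deriv_uncertainty_eq {W : World N M} {S S' : Scenario N M} {j : Fin N}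
    {R R' : Plan → Fin M → ℝ → ℝ} {p : Plan}
    (h : Indistinguishable W S S' (R p) (R' p) j) (hp : S.plan j = p)
    (hR : ∀ p, IsUncertainty W (S.withPlan j p) (R p))
    (hR' : ∀ p, IsUncertainty W (S'.withPlan j p) (R' p)) (c : Param) (i : Fin M)
    (hdiff : ∀ᵐ t ∂(volume.restrict (Icc 0 W.T)),
      DifferentiableAt ℝ (fun v => R (p.withValue c v) i t) (p.value c))
    (hdiff' : ∀ᵐ t ∂(volume.restrict (Icc 0 W.T)),
      DifferentiableAt ℝ (fun v => R' (p.withValue c v) i t) (p.value c))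
    {t : ℝ} (ht : t ∈ Ico 0 W.T)
    (hdt : DifferentiableAt ℝ (fun v => R (p.withValue c v) i t) (p.value c))
    (hdt' : DifferentiableAt ℝ (fun v => R' (p.withValue c v) i t) (p.value c)) :
    deriv (fun v => R (p.withValue c v) i t) (p.value c) =
      deriv (fun v => R' (p.withValue c v) i t) (p.value c) := by
  have ht' : t ∈ Icc 0 W.T := ⟨ht.1, ht.2.le⟩
  obtain ⟨a, ha, ha0, hpos⟩ := h.uncertainty.exists_last_zero i ht'
  obtain ⟨a', ha', ha0', hpos'⟩ := h.uncertainty'.exists_last_zero i ht'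
  have hmin : ∀ v, R p i a ≤ R (p.withValue c v) i a := by
    intro v
    rcases ha0 with h0 | h0
    · rw [h0, (hR p).init, (hR (p.withValue c v)).init]; rfl
    · rw [h0]; exact (hR _).nonneg i a ⟨ha.1, ha.2.trans ht.2.le⟩
  have hmin' : ∀ v, R' p i a' ≤ R' (p.withValue c v) i a' := by
    intro v
    rcases ha0' with h0 | h0
    · rw [h0, (hR' p).init, (hR' (p.withValue c v)).init]; rfl
    · rw [h0]; exact (hR' _).nonneg i a' ⟨ha'.1, ha'.2.trans ht.2.le⟩
  have hd := hasDerivAt_integral_drift hR p c i hdiff ha.1 ha.2 ht.2.le hmin hpos hdt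
  have hd' := hasDerivAt_integral_drift hR' p c i hdiff' ha'.1 ha'.2 ht.2.le hmin' hpos' hdt'
  set Q := missByOthers W S j i with hQ
  set Q' := missByOthers W S' j i with hQ'
  set w : ℝ → ℝ := fun s => (Ioi a).indicator Q s - (Ioi a').indicator Q' s with hw
  have hmeas : AEStronglyMeasurable ((Ioi a).indicator Q) volume :=
    (continuous_missByOthers W S j i).aestronglyMeasurable.indicator measurableSet_Ioi
  have hmeas' : AEStronglyMeasurable ((Ioi a').indicator Q') volume :=
    (continuous_missByOthers W S' j i).aestronglyMeasurable.indicator measurableSet_Ioi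
  have hI : ∀ s, (Ioi a).indicator Q s ∈ Icc (0 : ℝ) 1 := fun s => by
    by_cases hs : s ∈ Ioi a
    · rw [indicator_of_mem hs]
      exact ⟨missByOthers_nonneg W S j i s, missByOthers_le_one W S j i s⟩
    · rw [indicator_of_notMem hs]; exact ⟨le_rfl, zero_le_one⟩
  have hI' : ∀ s, (Ioi a').indicator Q' s ∈ Icc (0 : ℝ) 1 := fun s => by
    by_cases hs : s ∈ Ioi a'
    · rw [indicator_of_mem hs]
      exact ⟨missByOthers_nonneg W S' j i s, missByOthers_le_one W S' j i s⟩
    · rw [indicator_of_notMem hs]; exact ⟨le_rfl, zero_le_one⟩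
  have key := hasDerivAt_integral_detect_mul W j p c i (t := t) (w := w) (hmeas.sub hmeas')
    (fun s => abs_le.2 ⟨by linarith [(hI s).1, (hI' s).2], by linarith [(hI s).2, (hI' s).1]⟩) (by
      filter_upwards [h.feasible.ae_eventually_inRange i j] with s hs hst hin
      rw [uIoc_of_le ht.1] at hst
      have hin' : InRange W S i j s := by rw [InRange, Scenario.pos, hp]; exact hin
      have hright := hs hin'
      have hright' : ∀ᶠ t in 𝓝[>] s, InRange W S' i j t :=
        hright.mono fun u hu => (h.inRange_iff i u).1 hu
      have hsT : s ∈ Ico 0 W.T := ⟨hst.1.le, hst.2.trans_lt ht.2⟩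
      rcases lt_or_ge a s with h1 | h1 <;> rcases lt_or_ge a' s with h2 | h2
      · simp only [hw, indicator_of_mem (mem_Ioi.2 h1), indicator_of_mem (mem_Ioi.2 h2)]
        exact sub_eq_zero.2 (h.missByOthers_eq hsT hright)
      -- Since `a < a'`, the time `a'` is a genuine zero and not the default 0.
      · have h0 : R' p i a' = 0 :=
          ha0'.resolve_left fun h0 => (ha.1.trans_lt (h1.trans_le h2)).ne' h0
        exact absurd hright
          (h.not_inRange_of_depleted ha.1 ha'.2 ht.2 hpos h0 s ⟨h1, h2⟩)
      · have h0 : R p i a = 0 :=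
          ha0.resolve_left fun h0 => (ha'.1.trans_lt (h2.trans_le h1)).ne' h0
        exact absurd hright'
          (h.symm.not_inRange_of_depleted ha'.1 ha.2 ht.2 hpos' h0 s ⟨h2, h1⟩)
      · simp [hw, not_lt.2 h1, not_lt.2 h2])
  have hint : ∀ (q : Plan) (u : ℝ → ℝ), AEStronglyMeasurable u volume →
      (∀ s, u s ∈ Icc (0 : ℝ) 1) →
      IntervalIntegrable (fun s => detect W i j (q.position s) * u s) volume 0 t := by
    intro q u hu hu1
    refine (intervalIntegrable_const (c := (1 : ℝ))).mono_fun
      (((continuous_detect W i j).comp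
        q.continuous_position).aestronglyMeasurable.mul hu).restrict ?_
    refine Filter.Eventually.of_forall fun s => ?_
    beta_reduce
    rw [norm_mul, norm_one, Real.norm_eq_abs, Real.norm_eq_abs,
      abs_of_nonneg (detect_nonneg W i j _), abs_of_nonneg (hu1 s).1]
    exact mul_le_one₀ (detect_le_one W i j _) (hu1 s).1 (hu1 s).2
  -- Both derivatives are known to exist; only their difference is computed, so no derivative of a
  -- detection probability is needed.
  have hdiffw := hd.sub hd'
  have hfun : ((fun v => ∫ s in a..t, drift W (S.withPlan j (p.withValue c v)) i s) -
      fun v => ∫ s in a'..t, drift W (S'.withPlan j (p.withValue c v)) i s) = fun v =>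
      ((∫ s in a..t, (W.A i - W.B i + W.B i * Q s)) -
        ∫ s in a'..t, (W.A i - W.B i + W.B i * Q' s)) -
      W.B i * ∫ s in (0 : ℝ)..t, detect W i j ((p.withValue c v).position s) * w s := by
    ext v
    rw [Pi.sub_apply, integral_drift_withPlan W S j _ i ha.1 ha.2,
      integral_drift_withPlan W S' j _ i ha'.1 ha'.2]
    simp only [hw, mul_sub]
    rw [intervalIntegral.integral_sub (hint _ _ hmeas hI) (hint _ _ hmeas' hI')]
    ring
  have hzero := (key.const_mul (W.B i)).const_sub
    ((∫ s in a..t, (W.A i - W.B i + W.B i * Q s)) -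
        ∫ s in a'..t, (W.A i - W.B i + W.B i * Q' s))
  rw [hfun] at hdiffw
  have := hdiffw.unique hzero
  simp only [mul_zero, neg_zero] at this
  exact sub_eq_zero.1 this

/-! ### Differentiation of the cost -/

/-- The sensitivities of the uncertainties are integrable, and the cost may be differentiated under
the integral sign. -/
theorem hasDerivAt_cost {W : World N M} {S : Scenario N M} {j : Fin N}
    {R : Plan → Fin M → ℝ → ℝ} (hR : ∀ p, IsUncertainty W (S.withPlan j p) (R p)) (p : Plan)
    (c : Param)
    (hdiff : ∀ i, ∀ᵐ t ∂(volume.restrict (Icc 0 W.T)),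
      DifferentiableAt ℝ (fun v => R (p.withValue c v) i t) (p.value c)) :
    (∀ i, IntervalIntegrable (fun t => deriv (fun v => R (p.withValue c v) i t) (p.value c))
      volume 0 W.T) ∧
    HasDerivAt (fun v => cost W (R (p.withValue c v)))
      ((1 / W.T) * ∑ i, ∫ t in (0 : ℝ)..W.T,
        deriv (fun v => R (p.withValue c v) i t) (p.value c)) (p.value c) := by
  have hT := W.T_pos.le
  have hcont : ∀ q i, ContinuousOn (R q i) (uIcc 0 W.T) := fun q i => by
    rw [uIcc_of_le hT]; exact (hR q).cont i
  have hint : ∀ q i, IntervalIntegrable (R q i) volume 0 W.T := fun q i =>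
    (hcont q i).intervalIntegrable
  have hmeas : ∀ q i, AEStronglyMeasurable (R q i) (volume.restrict (uIoc 0 W.T)) := fun q i =>
    (hint q i).def'.aestronglyMeasurable
  have hdiff2 : ∀ i, ∀ᵐ t ∂(volume.restrict (uIoc 0 W.T)),
      DifferentiableAt ℝ (fun v => R (p.withValue c v) i t) (p.value c) := fun i => by
    rw [uIoc_of_le hT]
    exact ae_restrict_of_ae_restrict_of_subset Ioc_subset_Icc_self (hdiff i)
  have key : ∀ i, IntervalIntegrable
        (fun t => deriv (fun v => R (p.withValue c v) i t) (p.value c)) volume 0 W.T ∧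
      HasDerivAt (fun v => ∫ t in (0 : ℝ)..W.T, R (p.withValue c v) i t)
        (∫ t in (0 : ℝ)..W.T, deriv (fun v => R (p.withValue c v) i t) (p.value c))
        (p.value c) := by
    intro i
    obtain ⟨C, hC, hlip⟩ := exists_abs_uncertainty_withValue_sub_le hR p c i
    refine intervalIntegral.hasDerivAt_integral_of_dominated_loc_of_lip (μ := volume)
      (F := fun v t => R (p.withValue c v) i t) (s := univ) (bound := fun _ => C) univ_mem
      (Filter.Eventually.of_forall fun v => hmeas _ i) (hint _ i) ?_ ?_ intervalIntegrable_const ?_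
    -- The sensitivity is measurable as an almost everywhere limit of difference quotients with
    -- increments 1/(n + 1).
    · have hlim : Tendsto (fun n : ℕ => (1 / ((n : ℝ) + 1))) atTop (𝓝[≠] 0) := by
        refine tendsto_nhdsWithin_iff.2 ⟨tendsto_one_div_add_atTop_nhds_zero_nat,
          Filter.Eventually.of_forall fun n => ?_⟩
        simp only [mem_compl_iff, mem_singleton_iff]
        positivity
      refine aestronglyMeasurable_of_tendsto_ae atTop
        (f := fun (n : ℕ) t => (1 / ((n : ℝ) + 1))⁻¹ •
          (R (p.withValue c (p.value c + 1 / ((n : ℝ) + 1))) i t -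
            R (p.withValue c (p.value c)) i t))
        (fun n => ((hmeas (p.withValue c (p.value c + 1 / ((n : ℝ) + 1))) i).sub
          (hmeas (p.withValue c (p.value c)) i)).const_smul ((1 / ((n : ℝ) + 1))⁻¹)) ?_
      filter_upwards [hdiff2 i] with t ht
      exact ht.hasDerivAt.tendsto_slope_zero.comp hlim
    · refine Filter.Eventually.of_forall fun t ht => LipschitzOnWith.of_dist_le_mul
        fun v _ v' _ => ?_
      rw [uIoc_of_le hT] at ht
      rw [Real.dist_eq, Real.dist_eq, Real.coe_nnabs, abs_of_nonneg hC]
      exact hlip v v' t ⟨ht.1.le, ht.2⟩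
    · exact ((ae_restrict_iff' measurableSet_uIoc).1 (hdiff2 i)).mono
        fun t ht hmem => (ht hmem).hasDerivAt
  refine ⟨fun i => (key i).1, ?_⟩
  have hsum : (fun v => cost W (R (p.withValue c v))) = fun v =>
      (1 / W.T) * ∑ i, ∫ t in (0 : ℝ)..W.T, R (p.withValue c v) i t := by
    ext v
    rw [cost, intervalIntegral.integral_finsetSum fun i _ => hint _ i]
  rw [hsum]
  exact (HasDerivAt.fun_sum fun i _ => (key i).2).const_mul _

/-! ### Evaluation of the gradient from the observation -/

/-- The time average of the sensitivities of the uncertainties to a parameter of agent `j`. -/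
def averageSensitivity (W : World N M) (S : Scenario N M) (j : Fin N) (R : Plan → Fin M → ℝ → ℝ)
    (c : Param) : ℝ :=
  (1 / W.T) * ∑ i, ∫ t in (0 : ℝ)..W.T,
    deriv (fun v => R ((S.plan j).withValue c v) i t) ((S.plan j).value c)

/-- A feasible scenario with the uncertainties for all plans of agent `j`, in which the state
derivatives with respect to the parameter `c` exist. -/
structure IsAdmissible (W : World N M) (S : Scenario N M) (j : Fin N) (R : Plan → Fin M → ℝ → ℝ)
    (c : Param) : Prop where
  feasible : S.Feasible W
  uncertainty : ∀ p, IsUncertainty W (S.withPlan j p) (R p)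
  differentiable : ∀ i, ∀ᵐ t ∂(volume.restrict (Icc 0 W.T)),
    DifferentiableAt ℝ (fun v => R ((S.plan j).withValue c v) i t) ((S.plan j).value c)

theorem averageSensitivity_eq {W : World N M} {S S' : Scenario N M} {j : Fin N}
    {R R' : Plan → Fin M → ℝ → ℝ} {c : Param} (h : IsAdmissible W S j R c)
    (h' : IsAdmissible W S' j R' c) (hp : S.plan j = S'.plan j)
    (ho : observe W S (R (S.plan j)) j = observe W S' (R' (S'.plan j)) j) :
    averageSensitivity W S j R c = averageSensitivity W S' j R' c := by
  have hI : Indistinguishable W S S' (R (S.plan j)) (R' (S.plan j)) j :=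
    { feasible := h.feasible
      feasible' := h'.feasible
      uncertainty := by simpa using h.uncertainty (S.plan j)
      uncertainty' := by simpa [hp] using h'.uncertainty (S.plan j)
      plan_eq := hp
      observe_eq := by rw [ho, hp] }
  have hd' := h'.differentiable
  rw [← hp] at hd'
  rw [averageSensitivity, averageSensitivity, ← hp]
  congr 1
  refine Finset.sum_congr rfl fun i _ => ?_
  -- The endpoint `T` is dropped because the sensitivities are compared only before `T`; events at
  -- `T` are not observed.
  rw [intervalIntegral.integral_of_le W.T_pos.le, intervalIntegral.integral_of_le W.T_pos.le,
    integral_Ioc_eq_integral_Ioo, integral_Ioc_eq_integral_Ioo]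
  refine integral_congr_ae ?_
  have h1 := ae_restrict_of_ae_restrict_of_subset (Ioo_subset_Icc_self (a := 0) (b := W.T))
    (h.differentiable i)
  have h2 := ae_restrict_of_ae_restrict_of_subset (Ioo_subset_Icc_self (a := 0) (b := W.T)) (hd' i)
  filter_upwards [h1, h2, ae_restrict_mem measurableSet_Ioo] with t h1 h2 ht
  exact hI.deriv_uncertainty_eq rfl h.uncertainty h'.uncertainty c i (h.differentiable i) (hd' i)
    ⟨ht.1.le, ht.2⟩ h1 h2

end PersistentMonitoring

end

open PersistentMonitoring
theorem lemma2 {N M : ℕ} (W : World N M) (j : Fin N) :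
    ∃ Φ : Plan → Observation N M → Param → ℝ,
      ∀ S : Scenario N M, S.Feasible W →
      ∀ R : Plan → Fin M → ℝ → ℝ, (∀ p, IsUncertainty W (S.withPlan j p) (R p)) →
      ∀ c ∈ (S.plan j).params, (∀ l, c = .dwell l → 0 < (S.plan j).dwell l) →
        (∀ i, ∀ᵐ t ∂(volume.restrict (Icc 0 W.T)),
          DifferentiableAt ℝ (fun v => R ((S.plan j).withValue c v) i t) ((S.plan j).value c)) →
        (∀ i, IntervalIntegrable
          (fun t => deriv (fun v => R ((S.plan j).withValue c v) i t) ((S.plan j).value c))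
          volume 0 W.T) ∧
        Φ (S.plan j) (observe W S (R (S.plan j)) j) c =
          (1 / W.T) * ∑ i, ∫ t in (0 : ℝ)..W.T,
            deriv (fun v => R ((S.plan j).withValue c v) i t) ((S.plan j).value c) ∧
        HasDerivAt (fun v => cost W (R ((S.plan j).withValue c v)))
          (Φ (S.plan j) (observe W S (R (S.plan j)) j) c) ((S.plan j).value c) := by
  classical
  -- Φ evaluates the average sensitivity in an arbitrarily chosen admissible scenario with the given
  -- plan and observation; the value 0 is a default when none exists.
  let consistent : Plan → Observation N M → Param →
      Scenario N M × (Plan → Fin M → ℝ → ℝ) → Prop := fun p o c q =>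
    IsAdmissible W q.1 j q.2 c ∧ q.1.plan j = p ∧ observe W q.1 (q.2 (q.1.plan j)) j = o
  refine ⟨fun p o c => if h : ∃ q, consistent p o c q then
    averageSensitivity W h.choose.1 j h.choose.2 c else 0, ?_⟩
  intro S hS R hR c _ _ hdiff
  have hadm : IsAdmissible W S j R c := ⟨hS, hR, hdiff⟩
  have hex : ∃ q, consistent (S.plan j) (observe W S (R (S.plan j)) j) c q :=
    ⟨(S, R), hadm, rfl, rfl⟩
  obtain ⟨h1, h2, h3⟩ := hex.choose_spec
  have hΦ : (if h : ∃ q, consistent (S.plan j) (observe W S (R (S.plan j)) j) c q then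
      averageSensitivity W h.choose.1 j h.choose.2 c else 0) = averageSensitivity W S j R c := by
    rw [dif_pos hex]
    exact averageSensitivity_eq h1 hadm h2 h3
  obtain ⟨hint, hcost⟩ := hasDerivAt_cost hR (S.plan j) c hdiff
  refine ⟨hint, hΦ, ?_⟩
  beta_reduce
  rw [hΦ]
  exact hcost
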